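/- **Lemma D.** Let $n\ge 1$, let $M^n$ be a smooth $n$-manifold (Hausdorff, second countable) immersed in $\mathbb R^{n+1}$ as a hypersurface of constant mean curvature, with the induced metric, area measure $dM$ and second fundamental form $B$. *Domains.* A simple triple $(U,\Gamma,V)$ in $\mathbb R^n$ consists of an open set $U$ diffeomorphic to an $n$-ball, an open set $V$ of a hyperplane, diffeomorphic to an $(n-1)$-ball, and a set $\Gamma\subset\partial U$ which is the graph over $V$ of a function $u$; it is Lipschitz if $u$ is Lipschitz. A set $D\subset M$ is a generalized Lipschitz domain if there are a compact smooth $n$-manifold $D'$ with boundary and a smooth map $\rho:D'\to M$, which restricts to a diffeomorphism of $\operatorname{Int}D'$ onto $D$ and maps at most finitely many points of $\partial D'$ to any given point of $M$, and there are finitely many pairs $(U'_i,\Gamma'_i)$ with $U'_i\subset\operatorname{Int}D'$, $U'_i\cup\Gamma'_i$ open in $D'$ and $\bigcup_i\Gamma'_i=\partial D'$, such that in a suitable coordinate map of $D'$ each $(U'_i,\Gamma'_i)$ is part of a simple triple, and in a suitable coordinate map of $M$ each $(\rho(U'_i),\rho(\Gamma'_i))$ is part of a Lipschitz simple triple. A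 $C^0$-monotone continuum is a family $\{D(t)\subset M: t\in[0,b]\}$ of generalized Lipschitz domains with $D(s)\subsetneq D(t)$ for $s<t$, with $D(t)=\bigcup_{0\le s<t}D(s)$ for $0<t\le b$, $\overline{D(t)}=\bigcap_{t<r\le b}\overline{D(r)}$ for $0\le t<b$, and $\partial(\overline{D(t)})=\partial(D(t))$ for all $t\in[0,b]$. *Spaces and forms.* For $D=D(t)$ let $\mathcal F_0(D)=\{f\in C^\infty(D)\cap C^0(\overline D): f|_{\partial D}=0\}$ and $\mathcal G_0(D)=\{f\in\mathcal F_0(D):\int_D f\,dM=0\}$. Let $E_t$ and $H_t$ be the closures in the Sobolev space $W^{1,2}(D)$ of $\mathcal F_0(D)\cap W^{1,2}(D)$ and of $\mathcal G_0(D)\cap W^{1,2}(D)$, respectively. Let $I_t$ on $E_t$ and $\widetilde I_t$ on $H_t$ be the symmetric bilinear forms, both given by $$(f,g)\mapsto\int_D \left(Df\cdot Dg-|B|^2fg\right)dM,$$ which belong to the stability operator $Lf=-\Delta_M f-|B|^2f$ and to $\widetilde Lf=Lf-\frac1{|D|}\int_D Lf$, respectively. The Morse index of a form $J$ on a space $X$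 is $\dim W$, where $W$ is a linear subspace of $X$ that is maximal, with respect to inclusion, among those contained in the cone $\{x\in X: J(x,x)<0\}\cup\{0\}$. *Claim.* For every $C^0$-monotone continuum $\{D(t):t\in[0,b]\}$ in $M$ and every $t\in[0,b]$, the Morse indices $i(t)$ of $I_t$ (the Dirichlet index, of $L$ on $E_t$) and $\widetilde i(t)$ of $\widetilde I_t$ (the constrained index, of $\widetilde L$ on $H_t$) are well-defined finite numbers (such maximal subspaces exist, and all of them have the same finite dimension), and $$i(t)-1\le\widetilde i(t)\le i(t).$$ -/

import Mathlib

open scoped Manifold ContDiff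
open MeasureTheory Set

noncomputable section

namespace CMCIndex

/-! ### Generalized Lipschitz domains and monotone continua -/

section Domains

/-- An open set of a normed space which is `C^∞`-diffeomorphic to an open ball of that space. -/
def IsDiffeoToBall {E : Type*} [NormedAddCommGroup E] [NormedSpace ℝ E] (U : Set E) : Prop :=
  IsOpen U ∧ ∃ f g : E → E,
    ContDiffOn ℝ ∞ f U ∧ ContDiffOn ℝ ∞ g (Metric.ball 0 1) ∧
    MapsTo f U (Metric.ball 0 1) ∧ MapsTo g (Metric.ball 0 1) U ∧
    LeftInvOn g f U ∧ LeftInvOn f g (Metric.ball 0 1)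

/-- `(U, Γ, V)` is a simple triple in `ℝⁿ`: `U` is a simple domain, and `Γ ⊆ ∂U` is the graph, in
the direction of the unit vector `e`, of the function `u` over a simple domain `V` of the
hyperplane `eᗮ`. -/
def IsSimpleTriple {n : ℕ} (U Γ : Set (EuclideanSpace ℝ (Fin n))) (e : EuclideanSpace ℝ (Fin n))
    (V : Set (Submodule.span ℝ {e})ᗮ) (u : (Submodule.span ℝ {e})ᗮ → ℝ) : Prop :=
  ‖e‖ = 1 ∧ IsDiffeoToBall U ∧ IsDiffeoToBall V ∧
    Γ = (fun x : (Submodule.span ℝ {e})ᗮ => (x : EuclideanSpace ℝ (Fin n)) + u x • e) '' V ∧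
    Γ ⊆ frontier U

/-- `(U, Γ)` is part of a simple triple. -/
def IsSimple {n : ℕ} (U Γ : Set (EuclideanSpace ℝ (Fin n))) : Prop :=
  ∃ e V u, IsSimpleTriple U Γ e V u

/-- `(U, Γ)` is part of a Lipschitz simple domain: `Γ` is the graph of a Lipschitz function. -/
def IsLipschitzSimple {n : ℕ} (U Γ : Set (EuclideanSpace ℝ (Fin n))) : Prop :=
  ∃ e V u, IsSimpleTriple U Γ e V u ∧ ∃ K, LipschitzOnWith K u V

variable {n : ℕ} [NeZero n] {M : Type*} [TopologicalSpace M]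
  [ChartedSpace (EuclideanSpace ℝ (Fin n)) M]

/-- `ρ : D' → M` is a boundary gluing map: smooth up to the boundary, a diffeomorphism from the
interior of `D'` onto its image, and gluing at most finitely many boundary points together at any
point of `M`. -/
structure IsBoundaryGluingMap {D' : Type*} [TopologicalSpace D']
    [ChartedSpace (EuclideanHalfSpace n) D'] (ρ : D' → M) : Prop where
  contMDiff : ContMDiff (𝓡∂ n) (𝓡 n) ∞ ρ
  injOn : InjOn ρ ((𝓡∂ n).interior D')
  bijective_mfderiv : ∀ p ∈ (𝓡∂ n).interior D',
    Function.Bijective (mfderiv (𝓡∂ n) (𝓡 n) ρ p)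
  finite_fiber : ∀ q : M, {p | p ∈ (𝓡∂ n).boundary D' ∧ ρ p = q}.Finite

/-- A generalized Lipschitz domain `D = ρ(Int D')` of the `n`-manifold `M`.  The boundary of the
compact manifold `D'` is covered by finitely many triples `(U' i, Γ' i, _)`, with
`U' i ⊆ Int D'` open and `U' i ∪ Γ' i` a neighbourhood of `Γ' i` in `D'`, each of which is a simple
triple in a coordinate map of `D'`, while its image under `ρ` is a Lipschitz simple domain in a
coordinate map of `M`. -/
def IsGenLipschitzDomain (n : ℕ) [NeZero n] {M : Type*} [TopologicalSpace M]
    [ChartedSpace (EuclideanSpace ℝ (Fin n)) M] (D : Set M) : Prop :=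
  ∃ (D' : Type) (_ : TopologicalSpace D') (_ : T2Space D') (_ : CompactSpace D')
    (_ : ChartedSpace (EuclideanHalfSpace n) D') (_ : IsManifold (𝓡∂ n) ∞ D') (ρ : D' → M),
    IsBoundaryGluingMap (n := n) ρ ∧ D = ρ '' (𝓡∂ n).interior D' ∧
    ∃ (ν : ℕ) (U' Γ' : Fin ν → Set D'),
      (⋃ i, Γ' i) = (𝓡∂ n).boundary D' ∧
      ∀ i, U' i ⊆ (𝓡∂ n).interior D' ∧ IsOpen (U' i ∪ Γ' i) ∧
        (∃ φ' ∈ IsManifold.maximalAtlas (𝓡∂ n) ∞ D', U' i ∪ Γ' i ⊆ φ'.source ∧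
          IsSimple (φ'.extend (𝓡∂ n) '' U' i) (φ'.extend (𝓡∂ n) '' Γ' i)) ∧
        (∃ φ ∈ IsManifold.maximalAtlas (𝓡 n) ∞ M, ρ '' (U' i ∪ Γ' i) ⊆ φ.source ∧
          IsLipschitzSimple (φ '' (ρ '' U' i)) (φ '' (ρ '' Γ' i)))

/-- A `C⁰`-monotone continuum `{D(t) : t ∈ [0,b]}`: a strictly increasing, set-continuous family of
generalized Lipschitz domains.  The two one-sided conditions are imposed at the parameters at which
the one-sided families are nonempty. -/
structure IsC0MonotoneContinuum (n : ℕ) [NeZero n] {M : Type*} [TopologicalSpace M]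
    [ChartedSpace (EuclideanSpace ℝ (Fin n)) M] (b : ℝ) (D : ℝ → Set M) : Prop where
  lipschitz : ∀ t ∈ Icc 0 b, IsGenLipschitzDomain n (D t)
  strictMono : ∀ s ∈ Icc 0 b, ∀ t ∈ Icc 0 b, s < t → D s ⊂ D t
  iUnion_left : ∀ t ∈ Ioc 0 b, D t = ⋃ s ∈ Ico 0 t, D s
  iInter_right : ∀ t ∈ Ico 0 b, closure (D t) = ⋂ r ∈ Ioc t b, closure (D r)
  frontier_closure : ∀ t ∈ Icc 0 b, frontier (closure (D t)) = frontier (D t)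

end Domains

/-! ### Immersed hypersurfaces of `ℝⁿ⁺¹` -/

/-- A smooth immersion of the `n`-manifold `M` into `ℝⁿ⁺¹`. -/
structure ImmersedHypersurface (n : ℕ) (M : Type*) [TopologicalSpace M]
    [ChartedSpace (EuclideanSpace ℝ (Fin n)) M] where
  toFun : M → EuclideanSpace ℝ (Fin (n + 1))
  contMDiff : ContMDiff (𝓡 n) 𝓘(ℝ, EuclideanSpace ℝ (Fin (n + 1))) ∞ toFun
  injective_mfderiv : ∀ p, Function.Injective
    (mfderiv (𝓡 n) 𝓘(ℝ, EuclideanSpace ℝ (Fin (n + 1))) toFun p)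

namespace ImmersedHypersurface

section Geometry

variable {n : ℕ} {M : Type*} [TopologicalSpace M] [ChartedSpace (EuclideanSpace ℝ (Fin n)) M]
  (γ : ImmersedHypersurface n M)

/-- The tangent plane of the hypersurface at `p`, as a subspace of `ℝⁿ⁺¹`. -/
def tangentPlane (p : M) : Submodule ℝ (EuclideanSpace ℝ (Fin (n + 1))) :=
  LinearMap.range (M := EuclideanSpace ℝ (Fin n)) (M₂ := EuclideanSpace ℝ (Fin (n + 1)))
    (mfderiv (𝓡 n) 𝓘(ℝ, EuclideanSpace ℝ (Fin (n + 1))) γ.toFun p).toLinearMap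

/-- The coordinate vector `∂ᵢX(y)`, where `X = γ ∘ φ⁻¹` is the local parametrization given by the
chart `φ`. -/
def coordVec (φ : OpenPartialHomeomorph M (EuclideanSpace ℝ (Fin n))) (i : Fin n)
    (y : EuclideanSpace ℝ (Fin n)) : EuclideanSpace ℝ (Fin (n + 1)) :=
  fderiv ℝ (γ.toFun ∘ φ.symm) y (EuclideanSpace.single i 1)

/-- The second derivative `∂ᵢ∂ⱼX(y)`, where `X = γ ∘ φ⁻¹`. -/
def coordHess (φ : OpenPartialHomeomorph M (EuclideanSpace ℝ (Fin n))) (i j : Fin n)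
    (y : EuclideanSpace ℝ (Fin n)) : EuclideanSpace ℝ (Fin (n + 1)) :=
  fderiv ℝ (γ.coordVec φ j) y (EuclideanSpace.single i 1)

/-- The matrix `g_{ij} = ⟨∂ᵢX, ∂ⱼX⟩` of the induced metric in the chart `φ`. -/
def metricMatrix (φ : OpenPartialHomeomorph M (EuclideanSpace ℝ (Fin n)))
    (y : EuclideanSpace ℝ (Fin n)) : Matrix (Fin n) (Fin n) ℝ :=
  Matrix.gram ℝ fun i => γ.coordVec φ i y

/-- The matrix `⟨∂ᵢ∂ⱼX, N⟩` at `p`, in the preferred chart at `p`.  For a unit normal `N` these are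
the coefficients `h_{ij}` of the second fundamental form. -/
def hessMatrix (p : M) (N : EuclideanSpace ℝ (Fin (n + 1))) : Matrix (Fin n) (Fin n) ℝ :=
  Matrix.of fun i j =>
    inner ℝ (γ.coordHess (chartAt (EuclideanSpace ℝ (Fin n)) p) i j (chartAt _ p p)) N

/-- The shape operator `(g⁻¹ h)` at `p` relative to `N`, in the preferred chart at `p`. -/
def shapeMatrix (p : M) (N : EuclideanSpace ℝ (Fin (n + 1))) : Matrix (Fin n) (Fin n) ℝ :=
  (γ.metricMatrix (chartAt (EuclideanSpace ℝ (Fin n)) p) (chartAt _ p p))⁻¹ * γ.hessMatrix p N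

/-- The mean curvature `(1/n) g^{ij} h_{ij}` at `p` relative to the unit normal `N`. -/
def meanCurvature (p : M) (N : EuclideanSpace ℝ (Fin (n + 1))) : ℝ :=
  (γ.shapeMatrix p N).trace / n

/-- The square length `|B|² = g^{ik} g^{jl} h_{ij} h_{kl}` of the second fundamental form at `p`.
It is written without a choice of the unit normal, as the sum of the square lengths of the `n + 1`
components of the normal-valued form `B_{ij} = (∂ᵢ∂ⱼX)^⊥ = h_{ij} N`; recall that
`⟨(∂ᵢ∂ⱼX)^⊥, e⟩ = ⟨∂ᵢ∂ⱼX, e^⊥⟩`. -/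
def normSqB (p : M) : ℝ :=
  ∑ a : Fin (n + 1),
    (γ.shapeMatrix p ((γ.tangentPlane p)ᗮ.starProjection (EuclideanSpace.single a 1)) *
      γ.shapeMatrix p ((γ.tangentPlane p)ᗮ.starProjection (EuclideanSpace.single a 1))).trace

/-- The hypersurface has constant mean curvature: near each point there is a continuous unit normal
field relative to which the mean curvature is one and the same constant `H₀`. -/
def IsCMC : Prop :=
  ∃ H₀ : ℝ, ∀ p : M, ∃ U : Set M, IsOpen U ∧ p ∈ U ∧
    ∃ N : M → EuclideanSpace ℝ (Fin (n + 1)), ContinuousOn N U ∧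
      ∀ q ∈ U, ‖N q‖ = 1 ∧ N q ∈ (γ.tangentPlane q)ᗮ ∧ γ.meanCurvature q (N q) = H₀

/-- The area measure in the domain of the chart `φ`: the image under `φ⁻¹` of the measure
`√(det g) dy` on the target of `φ`. -/
def chartArea [MeasurableSpace M] (φ : OpenPartialHomeomorph M (EuclideanSpace ℝ (Fin n))) :
    Measure M :=
  Measure.map φ.symm ((volume.restrict φ.target).withDensity
    fun y => ENNReal.ofReal (Real.sqrt (γ.metricMatrix φ y).det))

/-- The area measure `dM` of the induced metric: the smallest measure which dominates
`√(det g) dy` in every chart.  (The measures given by two charts agree on the overlap, so that this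
is the measure obtained by gluing them.) -/
def area [MeasurableSpace M] : Measure M :=
  ⨆ φ ∈ IsManifold.maximalAtlas (𝓡 n) ∞ M, γ.chartArea φ

end Geometry

/-! ### Sobolev spaces -/

section Sobolev

variable {n : ℕ} {M : Type*} [TopologicalSpace M] [ChartedSpace (EuclideanSpace ℝ (Fin n)) M]
  [MeasurableSpace M] (γ : ImmersedHypersurface n M) (D : Set M)

/-- `v` is the weak gradient of `f` on `D`: a tangential field (viewed in `ℝⁿ⁺¹`), such that in
every chart the weak partial derivatives of `f` are `∂ᵢf = ⟨v, ∂ᵢX⟩`. -/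
def IsWeakGradient (f : M → ℝ) (v : M → EuclideanSpace ℝ (Fin (n + 1))) : Prop :=
  (∀ᵐ p ∂γ.area.restrict D, v p ∈ γ.tangentPlane p) ∧
  ∀ φ ∈ IsManifold.maximalAtlas (𝓡 n) ∞ M, ∀ i : Fin n,
    ∀ η : EuclideanSpace ℝ (Fin n) → ℝ, ContDiff ℝ ∞ η → HasCompactSupport η →
      tsupport η ⊆ φ.target ∩ φ.symm ⁻¹' D →
      ∫ y, f (φ.symm y) * fderiv ℝ η y (EuclideanSpace.single i 1) =
        - ∫ y, inner ℝ (v (φ.symm y)) (γ.coordVec φ i y) * η y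

/-- The Hilbert space `L²(D) × L²(D; ℝⁿ⁺¹)`. -/
abbrev L2Pair : Type _ :=
  WithLp 2 (Lp ℝ 2 (γ.area.restrict D) ×
    Lp (EuclideanSpace ℝ (Fin (n + 1))) 2 (γ.area.restrict D))

end Sobolev

section Aux

variable {n : ℕ} {M : Type*} [TopologicalSpace M] [ChartedSpace (EuclideanSpace ℝ (Fin n)) M]
  (γ : ImmersedHypersurface n M)

theorem contDiffOn_param {φ : OpenPartialHomeomorph M (EuclideanSpace ℝ (Fin n))}
    (hφ : φ ∈ IsManifold.maximalAtlas (𝓡 n) ∞ M) :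
    ContDiffOn ℝ ∞ (γ.toFun ∘ φ.symm) φ.target :=
  (γ.contMDiff.comp_contMDiffOn (contMDiffOn_symm_of_mem_maximalAtlas hφ)).contDiffOn

theorem continuousOn_coordVec {φ : OpenPartialHomeomorph M (EuclideanSpace ℝ (Fin n))}
    (hφ : φ ∈ IsManifold.maximalAtlas (𝓡 n) ∞ M) (i : Fin n) :
    ContinuousOn (γ.coordVec φ i) φ.target :=
  ((γ.contDiffOn_param hφ).continuousOn_fderiv_of_isOpen φ.open_target (by simp)).clm_apply
    continuousOn_const

theorem det_metricMatrix_pos {φ : OpenPartialHomeomorph M (EuclideanSpace ℝ (Fin n))}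
    (hφ : φ ∈ IsManifold.maximalAtlas (𝓡 n) ∞ M) {y : EuclideanSpace ℝ (Fin n)}
    (hy : y ∈ φ.target) : 0 < (γ.metricMatrix φ y).det := by
  have hs : MDifferentiableAt (𝓡 n) (𝓡 n) φ.symm y :=
    ((contMDiffOn_symm_of_mem_maximalAtlas hφ).contMDiffAt
      (φ.open_target.mem_nhds hy)).mdifferentiableAt (by simp)
  have hf : MDifferentiableAt (𝓡 n) (𝓡 n) φ (φ.symm y) :=
    ((contMDiffOn_of_mem_maximalAtlas hφ).contMDiffAt
      (φ.open_source.mem_nhds (φ.map_target hy))).mdifferentiableAt (by simp)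
  have hγ : MDifferentiableAt (𝓡 n) 𝓘(ℝ, EuclideanSpace ℝ (Fin (n + 1))) γ.toFun (φ.symm y) :=
    γ.contMDiff.contMDiffAt.mdifferentiableAt (by simp)
  have hsi : Function.Injective (mfderiv (𝓡 n) (𝓡 n) φ.symm y) := by
    have h1 : mfderiv (𝓡 n) (𝓡 n) (φ ∘ φ.symm) y =
        (mfderiv (𝓡 n) (𝓡 n) φ (φ.symm y)).comp (mfderiv (𝓡 n) (𝓡 n) φ.symm y) :=
      mfderiv_comp y hf hs
    have h2 : mfderiv (𝓡 n) (𝓡 n) (φ ∘ φ.symm) y =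
        mfderiv (𝓡 n) (𝓡 n) (id : EuclideanSpace ℝ (Fin n) → _) y := by
      apply Filter.EventuallyEq.mfderiv_eq
      filter_upwards [φ.open_target.mem_nhds hy] with z hz using φ.right_inv hz
    rw [mfderiv_id] at h2
    intro a c hac
    have h3 := congrArg (mfderiv (𝓡 n) (𝓡 n) φ (φ.symm y)) hac
    have h4 : ∀ a, (mfderiv (𝓡 n) (𝓡 n) φ (φ.symm y)) ((mfderiv (𝓡 n) (𝓡 n) φ.symm y) a) = a := by
      intro a
      have := congrArg (fun l => l a) (h1.symm.trans h2)
      exact this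
    exact (h4 a).symm.trans (h3.trans (h4 c))
  have hinj : Function.Injective (fderiv ℝ (γ.toFun ∘ φ.symm) y) := by
    have h1 : mfderiv (𝓡 n) 𝓘(ℝ, EuclideanSpace ℝ (Fin (n + 1))) (γ.toFun ∘ φ.symm) y =
        (mfderiv (𝓡 n) 𝓘(ℝ, EuclideanSpace ℝ (Fin (n + 1))) γ.toFun (φ.symm y)).comp
          (mfderiv (𝓡 n) (𝓡 n) φ.symm y) := mfderiv_comp y hγ hs
    rw [mfderiv_eq_fderiv] at h1
    rw [h1]
    exact (γ.injective_mfderiv (φ.symm y)).comp hsi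
  have hli : LinearIndependent ℝ (fun i => γ.coordVec φ i y) := by
    have hb := (EuclideanSpace.basisFun (Fin n) ℝ).toBasis.linearIndependent
    have := hb.map' (fderiv ℝ (γ.toFun ∘ φ.symm) y).toLinearMap
      (LinearMap.ker_eq_bot.mpr hinj)
    have he : (fun i => γ.coordVec φ i y) =
        (fderiv ℝ (γ.toFun ∘ φ.symm) y).toLinearMap ∘
          (EuclideanSpace.basisFun (Fin n) ℝ).toBasis := by
      ext i
      simp [coordVec]
    rw [he]
    exact this
  exact (Matrix.posDef_gram_of_linearIndependent hli).det_pos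

variable [T2Space M] [MeasurableSpace M] [BorelSpace M] {D : Set M}

/-- On compact subsets of a chart, Lebesgue measure is dominated by a multiple of the area. -/
theorem exists_map_le_area {φ : OpenPartialHomeomorph M (EuclideanSpace ℝ (Fin n))}
    (hφ : φ ∈ IsManifold.maximalAtlas (𝓡 n) ∞ M) {K : Set (EuclideanSpace ℝ (Fin n))}
    (hK : IsCompact K) (hKD : K ⊆ φ.target ∩ φ.symm ⁻¹' D) :
    AEMeasurable φ.symm (volume.restrict K) ∧ ∃ c : ENNReal, c ≠ ⊤ ∧
      Measure.map φ.symm (volume.restrict K) ≤ c • γ.area.restrict D := by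
  have hKt : K ⊆ φ.target := fun y hy => (hKD hy).1
  have hcs : ContinuousOn φ.symm φ.target := φ.continuousOn_symm
  have hm : AEMeasurable φ.symm (volume.restrict K) :=
    (hcs.mono hKt).aemeasurable hK.measurableSet
  refine ⟨hm, ?_⟩
  have hcd : ContinuousOn (fun y => Real.sqrt (γ.metricMatrix φ y).det) φ.target := by
    refine Real.continuous_sqrt.comp_continuousOn ?_
    have : ContinuousOn (fun y => γ.metricMatrix φ y) φ.target := by
      refine continuousOn_pi.mpr fun i => continuousOn_pi.mpr fun j => ?_
      exact (γ.continuousOn_coordVec hφ i).inner (γ.continuousOn_coordVec hφ j)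
    exact (Continuous.matrix_det continuous_id).comp_continuousOn this
  obtain ⟨m, hm0, hmK⟩ : ∃ m : ℝ, 0 < m ∧ ∀ y ∈ K, m ≤ Real.sqrt (γ.metricMatrix φ y).det := by
    rcases K.eq_empty_or_nonempty with rfl | hne
    · exact ⟨1, one_pos, by simp⟩
    · obtain ⟨z, hz, hmin⟩ := hK.exists_isMinOn hne (hcd.mono hKt)
      exact ⟨_, Real.sqrt_pos.mpr (γ.det_metricMatrix_pos hφ (hKt hz)), fun y hy => hmin hy⟩
  set ν := (volume.restrict φ.target).withDensity
    fun y => ENNReal.ofReal (Real.sqrt (γ.metricMatrix φ y).det) with hν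
  have hmp : ENNReal.ofReal m ≠ 0 := by simpa using hm0
  have h1 : ENNReal.ofReal m • volume.restrict K ≤ ν.restrict K := by
    rw [hν, restrict_withDensity hK.measurableSet, Measure.restrict_restrict hK.measurableSet,
      inter_eq_left.mpr hKt, ← withDensity_const]
    refine withDensity_mono ?_
    filter_upwards [ae_restrict_mem hK.measurableSet] with y hy
    exact ENNReal.ofReal_le_ofReal (hmK y hy)
  have hma : AEMeasurable φ.symm ν :=
    (hcs.aemeasurable φ.open_target.measurableSet).mono_ac (withDensity_absolutelyContinuous _ _)
  refine ⟨(ENNReal.ofReal m)⁻¹, ENNReal.inv_ne_top.mpr hmp, Measure.le_iff.mpr fun S hS => ?_⟩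
  have hK' : MeasurableSet (φ.symm '' K) :=
    (hK.image_of_continuousOn (hcs.mono hKt)).isClosed.measurableSet
  have h2 : ENNReal.ofReal m * volume.restrict K (φ.symm ⁻¹' S) ≤ γ.area.restrict D S := by
    calc ENNReal.ofReal m * volume.restrict K (φ.symm ⁻¹' S)
        ≤ ν.restrict K (φ.symm ⁻¹' S) := h1 _
      _ = ν (φ.symm ⁻¹' S ∩ K) := Measure.restrict_apply' hK.measurableSet
      _ ≤ ν (φ.symm ⁻¹' (S ∩ φ.symm '' K)) :=
          measure_mono fun y hy => ⟨hy.1, mem_image_of_mem _ hy.2⟩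
      _ = γ.chartArea φ (S ∩ φ.symm '' K) :=
          (Measure.map_apply_of_aemeasurable hma (hS.inter hK')).symm
      _ ≤ γ.area (S ∩ φ.symm '' K) :=
          (le_iSup₂ (f := fun φ (_ : φ ∈ IsManifold.maximalAtlas (𝓡 n) ∞ M) => γ.chartArea φ)
            φ hφ) _
      _ ≤ γ.area (S ∩ D) := by
          refine measure_mono (inter_subset_inter_right _ ?_)
          rintro _ ⟨y, hy, rfl⟩
          exact (hKD hy).2
      _ = γ.area.restrict D S := (Measure.restrict_apply hS).symm
  rw [Measure.map_apply_of_aemeasurable hm hS, Measure.smul_apply, smul_eq_mul, mul_comm,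
    ← div_eq_mul_inv, ENNReal.le_div_iff_mul_le (Or.inl hmp) (Or.inl ENNReal.ofReal_ne_top),
    mul_comm]
  exact h2

/-- Almost everywhere statements on `D` can be read in a chart. -/
theorem ae_comp_symm {φ : OpenPartialHomeomorph M (EuclideanSpace ℝ (Fin n))}
    (hφ : φ ∈ IsManifold.maximalAtlas (𝓡 n) ∞ M) {K : Set (EuclideanSpace ℝ (Fin n))}
    (hK : IsCompact K) (hKD : K ⊆ φ.target ∩ φ.symm ⁻¹' D) {P : M → Prop}
    (hP : ∀ᵐ p ∂γ.area.restrict D, P p) : ∀ᵐ y ∂volume.restrict K, P (φ.symm y) := by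
  obtain ⟨hm, c, -, hle⟩ := γ.exists_map_le_area hφ hK hKD
  exact ae_of_ae_map hm ((hle.absolutelyContinuous.trans
    Measure.smul_absolutelyContinuous).ae_le hP)

/-- Square integrable functions on `D` are integrable over compact subsets of a chart. -/
theorem integrableOn_comp_symm {φ : OpenPartialHomeomorph M (EuclideanSpace ℝ (Fin n))}
    (hφ : φ ∈ IsManifold.maximalAtlas (𝓡 n) ∞ M) {K : Set (EuclideanSpace ℝ (Fin n))}
    (hK : IsCompact K) (hKD : K ⊆ φ.target ∩ φ.symm ⁻¹' D)
    {F : Type*} [NormedAddCommGroup F] (f : Lp F 2 (γ.area.restrict D)) :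
    IntegrableOn (fun y => f (φ.symm y)) K := by
  obtain ⟨hm, c, hc, hle⟩ := γ.exists_map_le_area hφ hK hKD
  have h := ((Lp.memLp f).of_measure_le_smul hc hle).comp_of_map hm
  have : IsFiniteMeasure (volume.restrict K) := ⟨by simpa using hK.measure_lt_top⟩
  exact h.integrable (by norm_num)

theorem integrable_mul_test {φ : OpenPartialHomeomorph M (EuclideanSpace ℝ (Fin n))}
    (hφ : φ ∈ IsManifold.maximalAtlas (𝓡 n) ∞ M) {η : EuclideanSpace ℝ (Fin n) → ℝ}
    (hη : ContDiff ℝ ∞ η) (hc : HasCompactSupport η)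
    (hs : tsupport η ⊆ φ.target ∩ φ.symm ⁻¹' D) (f : Lp ℝ 2 (γ.area.restrict D)) (i : Fin n) :
    Integrable fun y => f (φ.symm y) * fderiv ℝ η y (EuclideanSpace.single i 1) := by
  have hd : Continuous fun y => fderiv ℝ η y (EuclideanSpace.single i 1) :=
    (hη.continuous_fderiv (by simp)).clm_apply continuous_const
  have h := (γ.integrableOn_comp_symm hφ hc hs f).mul_continuousOn hd.continuousOn hc
  refine (integrableOn_iff_integrable_of_support_subset ?_).mp h
  intro y hy
  by_contra hn
  refine hy ?_
  have : fderiv ℝ η y = 0 := by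
    by_contra h0
    exact hn (support_fderiv_subset ℝ h0)
  simp [this]

theorem integrable_inner_test {φ : OpenPartialHomeomorph M (EuclideanSpace ℝ (Fin n))}
    (hφ : φ ∈ IsManifold.maximalAtlas (𝓡 n) ∞ M) {η : EuclideanSpace ℝ (Fin n) → ℝ}
    (hη : ContDiff ℝ ∞ η) (hc : HasCompactSupport η)
    (hs : tsupport η ⊆ φ.target ∩ φ.symm ⁻¹' D)
    (v : Lp (EuclideanSpace ℝ (Fin (n + 1))) 2 (γ.area.restrict D)) (i : Fin n) :
    Integrable fun y => inner ℝ (v (φ.symm y)) (γ.coordVec φ i y) * η y := by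
  have hv := γ.integrableOn_comp_symm hφ hc hs v
  have hX : ContinuousOn (γ.coordVec φ i) (tsupport η) :=
    (γ.continuousOn_coordVec hφ i).mono fun y hy => (hs hy).1
  obtain ⟨C, hC⟩ := hc.exists_bound_of_continuousOn hX
  have h1 : IntegrableOn (fun y => inner ℝ (v (φ.symm y)) (γ.coordVec φ i y)) (tsupport η) := by
    refine Integrable.mono' (hv.norm.mul_const C)
      (hv.aestronglyMeasurable.inner (hX.aestronglyMeasurable hc.measurableSet)) ?_
    filter_upwards [ae_restrict_mem hc.measurableSet] with y hy
    exact (norm_inner_le_norm _ _).trans (mul_le_mul_of_nonneg_left (hC y hy) (norm_nonneg _))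
  have h := h1.mul_continuousOn hη.continuous.continuousOn hc
  refine (integrableOn_iff_integrable_of_support_subset ?_).mp h
  intro y hy
  exact subset_tsupport _ (right_ne_zero_of_mul hy)

end Aux

section Spaces

variable {n : ℕ} {M : Type*} [TopologicalSpace M] [ChartedSpace (EuclideanSpace ℝ (Fin n)) M]
  [T2Space M] [MeasurableSpace M] [BorelSpace M] (γ : ImmersedHypersurface n M) (D : Set M)

/-- The Sobolev space `W^{1,2}(D)`, as the space of pairs `(f, Df)` of a function in `L²(D)` and
its weak gradient in `L²(D)`, with `‖f‖² = ∫ |f|² + ∫ |Df|²`. -/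
def W12 : Submodule ℝ (γ.L2Pair D) where
  carrier := {u | γ.IsWeakGradient D u.fst u.snd}
  zero_mem' := by
    refine ⟨?_, fun φ hφ i η hη hc hs => ?_⟩
    · filter_upwards [Lp.coeFn_zero (EuclideanSpace ℝ (Fin (n + 1))) 2 (γ.area.restrict D)]
        with p hp
      simp only [WithLp.zero_snd, hp, Pi.zero_apply]
      exact Submodule.zero_mem _
    · have h1 := γ.ae_comp_symm hφ hc hs (Lp.coeFn_zero ℝ 2 (γ.area.restrict D))
      have h2 := γ.ae_comp_symm hφ hc hs
        (Lp.coeFn_zero (EuclideanSpace ℝ (Fin (n + 1))) 2 (γ.area.restrict D))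
      rw [ae_restrict_iff' hc.measurableSet] at h1 h2
      rw [integral_eq_zero_of_ae, integral_eq_zero_of_ae, neg_zero]
      · filter_upwards [h2] with y hy
        by_cases hyt : y ∈ tsupport η
        · simp only [WithLp.zero_snd, hy hyt, Pi.zero_apply, inner_zero_left, zero_mul]
        · simp [image_eq_zero_of_notMem_tsupport hyt]
      · filter_upwards [h1] with y hy
        by_cases hyt : y ∈ tsupport η
        · simp only [WithLp.zero_fst, hy hyt, Pi.zero_apply, zero_mul]
        · simp [fderiv_of_notMem_tsupport ℝ hyt]
  add_mem' := by
    rintro u w ⟨hu1, hu2⟩ ⟨hw1, hw2⟩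
    refine ⟨?_, fun φ hφ i η hη hc hs => ?_⟩
    · filter_upwards [Lp.coeFn_add u.snd w.snd, hu1, hw1] with p hp hpu hpw
      simp only [WithLp.add_snd, hp, Pi.add_apply]
      exact Submodule.add_mem _ hpu hpw
    · have h1 := γ.ae_comp_symm hφ hc hs (Lp.coeFn_add u.fst w.fst)
      have h2 := γ.ae_comp_symm hφ hc hs (Lp.coeFn_add u.snd w.snd)
      rw [ae_restrict_iff' hc.measurableSet] at h1 h2
      have e1 : ∫ y, (u + w).fst (φ.symm y) * fderiv ℝ η y (EuclideanSpace.single i 1) =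
          ∫ y, (u.fst (φ.symm y) * fderiv ℝ η y (EuclideanSpace.single i 1) +
            w.fst (φ.symm y) * fderiv ℝ η y (EuclideanSpace.single i 1)) := by
        refine integral_congr_ae ?_
        filter_upwards [h1] with y hy
        by_cases hyt : y ∈ tsupport η
        · simp only [WithLp.add_fst, hy hyt, Pi.add_apply, add_mul]
        · simp [fderiv_of_notMem_tsupport ℝ hyt]
      have e2 : ∫ y, inner ℝ ((u + w).snd (φ.symm y)) (γ.coordVec φ i y) * η y =
          ∫ y, (inner ℝ (u.snd (φ.symm y)) (γ.coordVec φ i y) * η y +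
            inner ℝ (w.snd (φ.symm y)) (γ.coordVec φ i y) * η y) := by
        refine integral_congr_ae ?_
        filter_upwards [h2] with y hy
        by_cases hyt : y ∈ tsupport η
        · simp only [WithLp.add_snd, hy hyt, Pi.add_apply, inner_add_left, add_mul]
        · simp [image_eq_zero_of_notMem_tsupport hyt]
      rw [e1, e2, integral_add (γ.integrable_mul_test hφ hη hc hs _ i)
        (γ.integrable_mul_test hφ hη hc hs _ i),
        integral_add (γ.integrable_inner_test hφ hη hc hs _ i)
        (γ.integrable_inner_test hφ hη hc hs _ i), hu2 φ hφ i η hη hc hs,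
        hw2 φ hφ i η hη hc hs, neg_add]
  smul_mem' := by
    rintro a u ⟨hu1, hu2⟩
    refine ⟨?_, fun φ hφ i η hη hc hs => ?_⟩
    · filter_upwards [Lp.coeFn_smul a u.snd, hu1] with p hp hpu
      simp only [WithLp.smul_snd, hp, Pi.smul_apply]
      exact Submodule.smul_mem _ _ hpu
    · have h1 := γ.ae_comp_symm hφ hc hs (Lp.coeFn_smul a u.fst)
      have h2 := γ.ae_comp_symm hφ hc hs (Lp.coeFn_smul a u.snd)
      rw [ae_restrict_iff' hc.measurableSet] at h1 h2
      have e1 : ∫ y, (a • u).fst (φ.symm y) * fderiv ℝ η y (EuclideanSpace.single i 1) =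
          ∫ y, a * (u.fst (φ.symm y) * fderiv ℝ η y (EuclideanSpace.single i 1)) := by
        refine integral_congr_ae ?_
        filter_upwards [h1] with y hy
        by_cases hyt : y ∈ tsupport η
        · simp only [WithLp.smul_fst, hy hyt, Pi.smul_apply, smul_eq_mul, mul_assoc]
        · simp [fderiv_of_notMem_tsupport ℝ hyt]
      have e2 : ∫ y, inner ℝ ((a • u).snd (φ.symm y)) (γ.coordVec φ i y) * η y =
          ∫ y, a * (inner ℝ (u.snd (φ.symm y)) (γ.coordVec φ i y) * η y) := by
        refine integral_congr_ae ?_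
        filter_upwards [h2] with y hy
        by_cases hyt : y ∈ tsupport η
        · simp only [WithLp.smul_snd, hy hyt, Pi.smul_apply, real_inner_smul_left, mul_assoc]
        · simp [image_eq_zero_of_notMem_tsupport hyt]
      rw [e1, e2, integral_const_mul, integral_const_mul, hu2 φ hφ i η hη hc hs, mul_neg]

/-- `𝓕₀(D) = {f ∈ C^∞(D) ∩ C⁰(closure D) : f = 0 on ∂D}`. -/
def F₀ (n : ℕ) {M : Type*} [TopologicalSpace M] [ChartedSpace (EuclideanSpace ℝ (Fin n)) M]
    (D : Set M) : Submodule ℝ (M → ℝ) where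
  carrier := {f | ContMDiffOn (𝓡 n) 𝓘(ℝ, ℝ) ∞ f D ∧ ContinuousOn f (closure D) ∧
    ∀ p ∈ frontier D, f p = 0}
  zero_mem' := ⟨contMDiffOn_const, continuousOn_const, fun _ _ => rfl⟩
  add_mem' := fun ⟨h1, h2, h3⟩ ⟨k1, k2, k3⟩ =>
    ⟨h1.add k1, h2.add k2, fun p hp => by simp [h3 p hp, k3 p hp]⟩
  smul_mem' := fun a _ ⟨h1, h2, h3⟩ =>
    ⟨((contDiff_const_smul a).contMDiff).comp_contMDiffOn h1, h2.const_smul a, fun p hp => by simp [h3 p hp]⟩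

/-- `𝓖₀(D) = {f ∈ 𝓕₀(D) : ∫_D f dM = 0}`. -/
def G₀ : Submodule ℝ (M → ℝ) where
  carrier := {f | f ∈ F₀ n D ∧ IntegrableOn f D γ.area ∧ ∫ p in D, f p ∂γ.area = 0}
  zero_mem' := ⟨Submodule.zero_mem _, integrableOn_zero, by simp⟩
  add_mem' := fun ⟨h1, h2, h3⟩ ⟨k1, k2, k3⟩ =>
    ⟨Submodule.add_mem _ h1 k1, h2.add k2, by
      simp only [Pi.add_apply]; rw [integral_add h2 k2, h3, k3, add_zero]⟩
  smul_mem' := fun a _ ⟨h1, h2, h3⟩ =>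
    ⟨Submodule.smul_mem _ a h1, h2.smul a, by
      simp only [Pi.smul_apply, integral_smul, h3, smul_zero]⟩

/-- `S ∩ W^{1,2}(D)`, for a space `S` of functions: the elements of `W^{1,2}(D)` which are almost
everywhere equal to a function in `S`. -/
def interW12 (S : Submodule ℝ (M → ℝ)) : Submodule ℝ (γ.W12 D) where
  carrier := {u | ∃ f ∈ S, u.1.fst =ᵐ[γ.area.restrict D] f}
  zero_mem' := ⟨0, Submodule.zero_mem _, Lp.coeFn_zero _ _ _⟩
  add_mem' := fun ⟨f, hf, hu⟩ ⟨g, hg, hw⟩ =>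
    ⟨f + g, Submodule.add_mem _ hf hg, (Lp.coeFn_add _ _).trans (hu.add hw)⟩
  smul_mem' := fun a _ ⟨f, hf, hu⟩ =>
    ⟨a • f, Submodule.smul_mem _ a hf, (Lp.coeFn_smul _ _).trans (hu.const_smul a)⟩

/-- `E(D)`, the closure of `𝓕₀(D) ∩ W^{1,2}(D)` in `W^{1,2}(D)`. -/
def spaceE : Submodule ℝ (γ.W12 D) := (γ.interW12 D (F₀ n D)).topologicalClosure

/-- `H(D)`, the closure of `𝓖₀(D) ∩ W^{1,2}(D)` in `W^{1,2}(D)`. -/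
def spaceH : Submodule ℝ (γ.W12 D) := (γ.interW12 D (γ.G₀ D)).topologicalClosure

/-- The form `∫_D (Df · Dg - |B|² f g) dM` on `W^{1,2}(D)`. -/
def stabilityForm (f g : γ.W12 D) : ℝ :=
  ∫ p in D, (inner ℝ (f.1.snd p) (g.1.snd p) - γ.normSqB p * (f.1.fst p * g.1.fst p)) ∂γ.area

/-- The form `I` of the stability operator `L = -Δ - |B|²` on `E(D)`. -/
def formI (f g : γ.spaceE D) : ℝ := γ.stabilityForm D f g

/-- The form `Ĩ` of the twisted stability operator `L̃ f = L f - |D|⁻¹ ∫_D L f` on `H(D)`. -/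
def formITilde (f g : γ.spaceH D) : ℝ := γ.stabilityForm D f g

end Spaces

end ImmersedHypersurface

/-! ### The Morse index of a form -/

/-- The unstable cone `Λ₋ = {x : I(x,x) < 0} ∪ {0}`. -/
def unstableCone {X : Type*} [Zero X] (I : X → X → ℝ) : Set X :=
  {x | I x x < 0} ∪ {0}

/-- `k` is the Morse index of `I`: it is the dimension of `W`, where `W` is a maximal (for
inclusion) linear subspace contained in the unstable cone.  Such `W` exist, and all of them have
the dimension `k`. -/
def IsMorseIndex {X : Type*} [AddCommGroup X] [Module ℝ X] (I : X → X → ℝ) (k : ℕ) : Prop :=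
  (∃ W : Submodule ℝ X, Maximal (fun V : Submodule ℝ X => (V : Set X) ⊆ unstableCone I) W) ∧
  ∀ W : Submodule ℝ X, Maximal (fun V : Submodule ℝ X => (V : Set X) ⊆ unstableCone I) W →
    FiniteDimensional ℝ W ∧ Module.finrank ℝ W = k

end CMCIndex
end

/-! A negative subspace cannot be large. On the relatively compact set `D` the continuous function
`|B|²` is bounded by some `C`, so `I(f,f) ≥ ‖Df‖² - C‖f‖²`. A quantitative Rellich inequality
(`exists_functionals_spaceE`) gives, for each `ε > 0`, finitely many continuous functionals on
`L²(D)` with `‖f‖² ≤ ∑ (Λ k f)² + ε‖Df‖²` for all `f` in `E`. For `ε = (C + 1)⁻¹` the form is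
nonnegative on the common kernel of the `Λ k`, so these embed every negative subspace in a fixed
`ℝ^ι`. Sylvester's argument (`finrank_le_of_maximal`) then shows that all maximal negative subspaces
have the same dimension.

The Rellich inequality comes from Poincaré's inequality on small cells: on a cell of diameter `d`,
the square integral of `f` is at most the contribution of its mean plus a multiple of `d²` times the
energy, and the means over the cells are the functionals (`exists_lintegral_cell_le`,
`exists_nhds_functionals`). The boundary of `D` causes no trouble, because functions in `F₀` are
extended by zero. The extension is continuous, and Poincaré's inequality is proved for continuous
functions that vanish off an open set and are differentiable on it
(`lintegral_lintegral_enorm_sub_sq_le`). Finitely many chart neighbourhoods cover the compact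
closure, and the inequality survives passing to the closure in `W^{1,2}`.

For the comparison of the two indices, `H` lies in `E` and contains every element of `E` of mean
value zero (`exists_functional_spaceH`), so it has codimension at most one. Negative subspaces of
`H` are negative in `E`, and a negative subspace of `E` loses at most one dimension when intersected
with the kernel of the mean (`exists_isMorseIndex_of_codim_le_one`).

The geometric input is that a generalized Lipschitz domain is open with compact closure, that the
area is given in each chart by `√(det g) dy`, and that `|B|²` is independent of the chart and hence
continuous. -/

namespace CMCIndex

/-! ### Linear algebra of the Morse index -/

section MorseIndex

variable {X : Type*} [AddCommGroup X] [Module ℝ X] {B : LinearMap.BilinForm ℝ X}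

theorem eq_zero_of_subset_unstableCone {W : Submodule ℝ X}
    (hW : (W : Set X) ⊆ unstableCone fun x y => B x y) {x : X} (hx : x ∈ W) (h : 0 ≤ B x x) :
    x = 0 := by
  rcases hW hx with h1 | h1
  · exact absurd h1 (not_lt.mpr h)
  · exact h1

/-- A maximal negative subspace of finite dimension bounds the dimension of every negative
subspace. -/
theorem finrank_le_of_maximal (hB : ∀ x y, B x y = B y x) {W V : Submodule ℝ X}
    (hW : Maximal (fun V : Submodule ℝ X => (V : Set X) ⊆ unstableCone fun x y => B x y) W)
    [FiniteDimensional ℝ W] [FiniteDimensional ℝ V]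
    (hV : (V : Set X) ⊆ unstableCone fun x y => B x y) :
    Module.finrank ℝ V ≤ Module.finrank ℝ W := by
  have hdisj : Disjoint W (B.orthogonal W) := by
    rw [Submodule.disjoint_def]
    intro x hx hx'
    refine eq_zero_of_subset_unstableCone hW.1 hx ?_
    exact (hx' x hx).ge
  -- By maximality: a vector orthogonal to `W` with `B x x < 0` could be adjoined to `W`, since the
  -- cross terms vanish and the enlarged space would stay in the unstable cone.
  have hpos : ∀ x ∈ B.orthogonal W, 0 ≤ B x x := by
    intro x hx
    by_contra hneg
    push Not at hneg
    have hsub : ((W ⊔ Submodule.span ℝ {x} : Submodule ℝ X) : Set X) ⊆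
        unstableCone fun x y => B x y := by
      intro z hz
      obtain ⟨w, hw, y, hy, rfl⟩ := Submodule.mem_sup.mp hz
      obtain ⟨a, rfl⟩ := Submodule.mem_span_singleton.mp hy
      have hwx : B w x = 0 := hx w hw
      have hxw : B x w = 0 := by rw [hB]; exact hwx
      have he : B (w + a • x) (w + a • x) = B w w + a ^ 2 * B x x := by
        simp [hwx, hxw]; ring
      by_cases ha : a = 0
      · simpa [ha] using hW.1 hw
      · left
        have h1 : a ^ 2 * B x x < 0 := mul_neg_of_pos_of_neg (by positivity) hneg
        have h2 : B w w ≤ 0 := by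
          rcases hW.1 hw with h | h
          · exact le_of_lt h
          · simp [show w = 0 from h]
        change B (w + a • x) (w + a • x) < 0
        rw [he]; linarith
    have hle := hW.2 hsub le_sup_left
    have hxW : x ∈ W := hle (Submodule.mem_sup_right (Submodule.mem_span_singleton_self x))
    have : x = 0 := (Submodule.disjoint_def.mp hdisj) x hxW hx
    simp [this] at hneg
  have hVd : Disjoint V (B.orthogonal W) := by
    rw [Submodule.disjoint_def]
    exact fun x hx hx' => eq_zero_of_subset_unstableCone hV hx (hpos x hx')
  -- The map sends `v` to the functional `B v ·` on `W`. Its kernel is the intersection of `V` with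
  -- the orthogonal space of `W`, where the form is both negative definite and nonnegative.
  have hinj : Function.Injective ((W.subtype.dualMap.comp B).comp V.subtype) := by
    rw [← LinearMap.ker_eq_bot, LinearMap.ker_eq_bot']
    intro v hv
    have : (v : X) ∈ B.orthogonal W := by
      intro w hw
      have h := congrArg (fun l => l ⟨w, hw⟩) hv
      change B w v = 0
      rw [hB]
      exact h
    exact Subtype.ext ((Submodule.disjoint_def.mp hVd) v v.2 this)
  exact (LinearMap.finrank_le_finrank_of_injective hinj).trans Subspace.dual_finrank_eq.le

/-- If finitely many linear functionals have no common zero where `B x x < 0`, the Morse index of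
`B` is well defined, and it is the largest dimension of a negative subspace. -/
theorem exists_isMorseIndex (hB : ∀ x y, B x y = B y x) {ι : Type*} [Fintype ι]
    (Λ : X →ₗ[ℝ] (ι → ℝ)) (hΛ : ∀ x, B x x < 0 → Λ x ≠ 0) :
    ∃ k : ℕ, IsMorseIndex (fun x y => B x y) k ∧
      (∃ W : Submodule ℝ X, (W : Set X) ⊆ unstableCone (fun x y => B x y) ∧
        FiniteDimensional ℝ W ∧ Module.finrank ℝ W = k) ∧
      ∀ W : Submodule ℝ X, (W : Set X) ⊆ unstableCone (fun x y => B x y) →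
        FiniteDimensional ℝ W ∧ Module.finrank ℝ W ≤ k := by
  have hfin : ∀ W : Submodule ℝ X, (W : Set X) ⊆ unstableCone (fun x y => B x y) →
      FiniteDimensional ℝ W ∧ Module.finrank ℝ W ≤ Fintype.card ι := by
    intro W hW
    -- A nonzero vector of a negative subspace is not killed by `Λ`, so `Λ` embeds the subspace in
    -- `ι → ℝ`.
    have hinj : Function.Injective (Λ.comp W.subtype) := by
      rw [← LinearMap.ker_eq_bot, LinearMap.ker_eq_bot']
      intro w hw
      rcases hW w.2 with h | h
      · exact absurd hw (hΛ w h)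
      · exact Subtype.ext h
    have hf : FiniteDimensional ℝ W := FiniteDimensional.of_injective _ hinj
    refine ⟨hf, ?_⟩
    have := LinearMap.finrank_le_finrank_of_injective hinj
    simpa using this
  have hex : ∃ k, ∃ W : Submodule ℝ X, (W : Set X) ⊆ unstableCone (fun x y => B x y) ∧
      Module.finrank ℝ W = k := by
    refine ⟨_, ⊥, ?_, rfl⟩
    rintro x hx
    exact Or.inr (by simpa using hx)
  classical
  have hbd : ∀ k, (∃ W : Submodule ℝ X, (W : Set X) ⊆ unstableCone (fun x y => B x y) ∧
      Module.finrank ℝ W = k) → k ≤ Fintype.card ι := by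
    rintro k ⟨W, hW, rfl⟩
    exact (hfin W hW).2
  obtain ⟨k₀, hk₀⟩ := hex
  -- A negative subspace of the largest dimension is maximal for inclusion. Any other maximal one
  -- has dimension at most `k` by the choice of `k`, and at least `k` by `finrank_le_of_maximal`.
  set k := Nat.findGreatest (fun k => ∃ W : Submodule ℝ X,
    (W : Set X) ⊆ unstableCone (fun x y => B x y) ∧ Module.finrank ℝ W = k) (Fintype.card ι)
  obtain ⟨W, hW, hWk⟩ : ∃ W : Submodule ℝ X,
      (W : Set X) ⊆ unstableCone (fun x y => B x y) ∧ Module.finrank ℝ W = k :=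
    Nat.findGreatest_spec (P := fun k => ∃ W : Submodule ℝ X,
      (W : Set X) ⊆ unstableCone (fun x y => B x y) ∧ Module.finrank ℝ W = k) (hbd _ hk₀) hk₀
  have hmax : ∀ V : Submodule ℝ X, (V : Set X) ⊆ unstableCone (fun x y => B x y) →
      Module.finrank ℝ V ≤ k := fun V hV =>
    Nat.le_findGreatest (hfin V hV).2 ⟨V, hV, rfl⟩
  have hWf := (hfin W hW).1
  refine ⟨k, ⟨⟨W, hW, fun V hV hle => ?_⟩, fun V hV => ?_⟩, ⟨W, hW, hWf, hWk⟩,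
    fun V hV => ⟨(hfin V hV).1, hmax V hV⟩⟩
  · have := (hfin V hV).1
    exact (Submodule.eq_of_le_of_finrank_le hle ((hmax V hV).trans hWk.ge)).ge
  · have := (hfin V hV.1).1
    exact ⟨this, le_antisymm (hmax V hV.1) (hWk.ge.trans (finrank_le_of_maximal hB hV hW))⟩

/-- The Morse indices of a form and of its restriction to a subspace of codimension at most one
differ by at most one. -/
theorem exists_isMorseIndex_of_codim_le_one (hB : ∀ x y, B x y = B y x) {ι : Type*} [Fintype ι]
    (Λ : X →ₗ[ℝ] (ι → ℝ)) (hΛ : ∀ x, B x x < 0 → Λ x ≠ 0) {Y : Type*} [AddCommGroup Y]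
    [Module ℝ Y] (T : Y →ₗ[ℝ] X) (hT : Function.Injective T) (ℓ : X →ₗ[ℝ] ℝ)
    (hℓ : LinearMap.ker ℓ ≤ LinearMap.range T) :
    ∃ i j : ℕ, IsMorseIndex (fun x y => B x y) i ∧
      IsMorseIndex (fun x y => B (T x) (T y)) j ∧ (i : ℤ) - 1 ≤ j ∧ j ≤ i := by
  obtain ⟨i, hi, ⟨W, hW, hWf, hWi⟩, himax⟩ := exists_isMorseIndex hB Λ hΛ
  obtain ⟨j, hj, ⟨V, hV, hVf, hVj⟩, hjmax⟩ :=
    exists_isMorseIndex (B := B.comp T T) (fun x y => hB _ _) (Λ.comp T) (fun x hx => hΛ _ hx)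
  refine ⟨i, j, hi, hj, ?_, ?_⟩
  -- Lower bound: the preimage of `W` is negative in `Y`, and its image in `X` contains `W ⊓ ker ℓ`,
  -- whose dimension is at least that of `W` minus one by rank-nullity.
  · have hsub : ((W.comap T : Submodule ℝ Y) : Set Y) ⊆
        unstableCone fun x y => (B.comp T T) x y := by
      intro y hy
      rcases hW (show T y ∈ W from hy) with h | h
      · exact Or.inl h
      · exact Or.inr (hT (by simpa using h))
    have h1 := (hjmax _ hsub).2
    have := (hjmax _ hsub).1
    have h2 : Module.finrank ℝ ((W.comap T).map T) = Module.finrank ℝ (W.comap T) :=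
      (Submodule.equivMapOfInjective T hT _).finrank_eq.symm
    have h3 : W ⊓ LinearMap.ker ℓ ≤ (W.comap T).map T := by
      rw [Submodule.map_comap_eq]
      exact le_inf (inf_le_right.trans hℓ) inf_le_left
    have h4 := Submodule.finrank_mono (R := ℝ) h3
    have h5 := LinearMap.finrank_range_add_finrank_ker (ℓ.comp W.subtype)
    have h6 : Module.finrank ℝ (LinearMap.range (ℓ.comp W.subtype)) ≤ 1 := by
      simpa using Submodule.finrank_le (LinearMap.range (ℓ.comp W.subtype))
    have h7 : Module.finrank ℝ (LinearMap.ker (ℓ.comp W.subtype)) =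
        Module.finrank ℝ (W ⊓ LinearMap.ker ℓ : Submodule ℝ X) := by
      rw [LinearMap.ker_comp, ← Submodule.map_comap_subtype]
      exact (Submodule.equivMapOfInjective _ (Submodule.injective_subtype W) _).finrank_eq
    omega
  · have hsub : ((V.map T : Submodule ℝ X) : Set X) ⊆ unstableCone fun x y => B x y := by
      rintro _ ⟨y, hy, rfl⟩
      rcases hV hy with h | h
      · exact Or.inl h
      · exact Or.inr (by simp [show y = 0 from h])
    have h1 := (himax _ hsub).2
    rw [← (Submodule.equivMapOfInjective T hT V).finrank_eq, hVj] at h1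
    exact h1

end MorseIndex

/-! ### Poincaré inequality on convex sets for functions extended by zero -/

section Poincare

open scoped ENNReal

/-- The fundamental theorem of calculus as an inequality in `[0, ∞]`. -/
theorem enorm_sub_le_lintegral_deriv {g : ℝ → ℝ} {a b : ℝ} (hab : a ≤ b)
    (hg : ContinuousOn g (Icc a b)) (hd : ∀ s ∈ Ioo a b, DifferentiableAt ℝ g s) :
    ‖g b - g a‖ₑ ≤ ∫⁻ s in Ioo a b, ‖deriv g s‖ₑ := by
  -- If the right side is infinite there is nothing to prove. If it is finite, the derivative is
  -- integrable, as the fundamental theorem of calculus requires.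
  by_cases h : ∫⁻ s in Ioo a b, ‖deriv g s‖ₑ = ⊤
  · simp [h]
  have hm : AEStronglyMeasurable (deriv g) (volume.restrict (Ioo a b)) :=
    (measurable_deriv g).aestronglyMeasurable
  have hi : IntegrableOn (deriv g) (Ioo a b) := ⟨hm, lt_top_iff_ne_top.mpr h⟩
  have hint : IntervalIntegrable (deriv g) volume a b := by
    rw [intervalIntegrable_iff_integrableOn_Ioo_of_le hab]
    exact hi
  have h1 := intervalIntegral.integral_eq_sub_of_hasDerivAt_of_le hab hg
    (fun x hx => (hd x hx).hasDerivAt) hint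
  rw [← h1, intervalIntegral.integral_of_le hab, integral_Ioc_eq_integral_Ioo]
  exact enorm_integral_le_lintegral_enorm _

/-- For a continuous function which vanishes off an open set and is differentiable on it, the
increment is controlled by the derivative on that set. -/
theorem enorm_sub_le_lintegral_deriv_inter {g : ℝ → ℝ} {O : Set ℝ}
    (hg : ContinuousOn g (Icc 0 1)) (hO : IsOpen O) (hd : ∀ s ∈ Ioo 0 1 ∩ O, DifferentiableAt ℝ g s)
    (h0 : ∀ s ∈ Icc 0 1, s ∉ O → g s = 0) :
    ‖g 1 - g 0‖ₑ ≤ ∫⁻ s in Ioo 0 1 ∩ O, ‖deriv g s‖ₑ := by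
  set S : Set ℝ := Icc 0 1 ∩ Oᶜ
  have hS : IsCompact S := isCompact_Icc.inter_right hO.isClosed_compl
  rcases S.eq_empty_or_nonempty with he | hne
  · have hsub : Icc (0 : ℝ) 1 ⊆ O := fun s hs => by
      by_contra hn
      exact (he ▸ (show s ∈ S from ⟨hs, hn⟩) : s ∈ (∅ : Set ℝ))
    have h1 : Ioo (0 : ℝ) 1 ∩ O = Ioo 0 1 :=
      inter_eq_left.mpr (Ioo_subset_Icc_self.trans hsub)
    rw [h1] at hd ⊢
    exact enorm_sub_le_lintegral_deriv zero_le_one hg hd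
  -- Let `a` and `c` be the first and last points off `O`. Since `g a = g c = 0`, only `(0, a)` and
  -- `(c, 1)` contribute to the increment, and both lie in `O`; the behaviour between `a` and `c` is
  -- irrelevant.
  · obtain ⟨a, ⟨ha, haO⟩, hmin⟩ := hS.exists_isLeast hne
    obtain ⟨c, ⟨hc, hcO⟩, hmax⟩ := hS.exists_isGreatest hne
    have hac : a ≤ c := hmin ⟨hc, hcO⟩
    have h1 : Ioo 0 a ⊆ Ioo (0 : ℝ) 1 ∩ O := fun s hs => by
      refine ⟨⟨hs.1, hs.2.trans_le ha.2⟩, ?_⟩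
      by_contra hn
      exact absurd (hmin ⟨⟨hs.1.le, hs.2.le.trans ha.2⟩, hn⟩) (not_le.mpr hs.2)
    have h2 : Ioo c 1 ⊆ Ioo (0 : ℝ) 1 ∩ O := fun s hs => by
      refine ⟨⟨hc.1.trans_lt hs.1, hs.2⟩, ?_⟩
      by_contra hn
      exact absurd (hmax ⟨⟨hc.1.trans hs.1.le, hs.2.le⟩, hn⟩) (not_le.mpr hs.1)
    have e1 := enorm_sub_le_lintegral_deriv ha.1 (hg.mono (Icc_subset_Icc_right ha.2))
      (fun s hs => hd s (h1 hs))
    have e2 := enorm_sub_le_lintegral_deriv hc.2 (hg.mono (Icc_subset_Icc_left hc.1))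
      (fun s hs => hd s (h2 hs))
    have hdisj : Disjoint (Ioo 0 a) (Ioo c 1) := by
      rw [Set.disjoint_left]
      intro s hs hs'
      linarith [hs.2, hs'.1]
    calc ‖g 1 - g 0‖ₑ = ‖(g a - g 0) + (g 1 - g c)‖ₑ := by
          rw [h0 a ha haO, h0 c hc hcO]; ring_nf
      _ ≤ ‖g a - g 0‖ₑ + ‖g 1 - g c‖ₑ := enorm_add_le _ _
      _ ≤ _ := add_le_add e1 e2
      _ = ∫⁻ s in Ioo 0 a ∪ Ioo c 1, ‖deriv g s‖ₑ :=
          (lintegral_union measurableSet_Ioo hdisj).symm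
      _ ≤ _ := lintegral_mono_set (union_subset h1 h2)

/-- Cauchy–Schwarz against the constant function `1`. -/
theorem lintegral_sq_le_of_measure_le_one {α : Type*} [MeasurableSpace α] {μ : Measure α}
    (hμ : μ univ ≤ 1) {f : α → ℝ≥0∞} (hf : AEMeasurable f μ) :
    (∫⁻ a, f a ∂μ) ^ 2 ≤ ∫⁻ a, f a ^ 2 ∂μ := by
  have h := ENNReal.lintegral_mul_le_Lp_mul_Lq μ Real.HolderConjugate.two_two hf
    (aemeasurable_const (b := (1 : ℝ≥0∞)))
  simp only [Pi.mul_apply, mul_one, ENNReal.one_rpow, lintegral_const, one_mul] at h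
  have h1 : (∫⁻ a, f a ∂μ) ≤ (∫⁻ a, f a ^ (2 : ℝ) ∂μ) ^ (1 / 2 : ℝ) := by
    refine h.trans (mul_le_of_le_one_right zero_le ?_)
    exact ENNReal.rpow_le_one hμ (by norm_num)
  calc (∫⁻ a, f a ∂μ) ^ 2 ≤ ((∫⁻ a, f a ^ (2 : ℝ) ∂μ) ^ (1 / 2 : ℝ)) ^ 2 := by gcongr
    _ = ∫⁻ a, f a ^ 2 ∂μ := by
      rw [← ENNReal.rpow_natCast, ← ENNReal.rpow_mul]
      simp

variable {E : Type*} [NormedAddCommGroup E] [NormedSpace ℝ E] [FiniteDimensional ℝ E]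
  [MeasurableSpace E] [BorelSpace E] (μ : Measure E) [μ.IsAddHaarMeasure]

theorem lintegral_comp_smul_add {h : E → ℝ≥0∞} (hh : Measurable h) {r : ℝ} (hr : 0 < r) (w : E) :
    ∫⁻ x, h (r • x + w) ∂μ =
      ENNReal.ofReal (|(r ^ Module.finrank ℝ E)⁻¹|) * ∫⁻ x, h x ∂μ := by
  have h1 : ∫⁻ x, h (r • x + w) ∂μ = ∫⁻ z, h (z + w) ∂(Measure.map (r • ·) μ) :=
    (lintegral_map (hh.comp (measurable_add_const w)) (measurable_const_smul r)).symm
  rw [h1, Measure.map_addHaar_smul μ hr.ne', lintegral_smul_measure, smul_eq_mul,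
    lintegral_add_right_eq_self]

/-- Poincaré inequality on a bounded convex set, for a continuous function which vanishes off an
open set and is differentiable on it. -/
theorem lintegral_lintegral_enorm_sub_sq_le {K O : Set E} (hK : Convex ℝ K) (hKm : MeasurableSet K)
    {d : ℝ} (hd : ∀ x ∈ K, ∀ y ∈ K, ‖y - x‖ ≤ d) (hO : IsOpen O) {F : E → ℝ}
    (hF : ContinuousOn F K) (hFd : ∀ x ∈ K ∩ O, DifferentiableAt ℝ F x)
    (hF0 : ∀ x ∈ K, x ∉ O → F x = 0) :
    ∫⁻ x in K, ∫⁻ y in K, ‖F y - F x‖ₑ ^ 2 ∂μ ∂μ ≤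
      ENNReal.ofReal (2 ^ Module.finrank ℝ E * d ^ 2) * μ K *
        ∫⁻ x in K ∩ O, ‖fderiv ℝ F x‖ₑ ^ 2 ∂μ := by
  have hKO : MeasurableSet (K ∩ O) := hKm.inter hO.measurableSet
  -- The squared gradient is set to zero off `K ∩ O`, so that integrals over `K` may later be
  -- enlarged to the whole space at no cost.
  set h : E → ℝ≥0∞ := (K ∩ O).indicator fun x => ‖fderiv ℝ F x‖ₑ ^ 2 with hh
  have hm : Measurable h := ((measurable_fderiv ℝ F).enorm.pow_const 2).indicator hKO
  set N : ℝ := 2 ^ Module.finrank ℝ E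
  set J : ℝ≥0∞ := ∫⁻ x, h x ∂μ
  have hJ' : ∫⁻ x in K ∩ O, ‖fderiv ℝ F x‖ₑ ^ 2 ∂μ = J := (lintegral_indicator hKO _).symm
  -- Integrate the derivative of `F` along the segment from `x` to `y`, which stays in `K` by
  -- convexity, and apply Cauchy–Schwarz in `s`.
  have key : ∀ x ∈ K, ∀ y ∈ K, ‖F y - F x‖ₑ ^ 2 ≤
      ENNReal.ofReal (d ^ 2) * ∫⁻ s in Ioo (0 : ℝ) 1, h ((1 - s) • x + s • y) := by
    intro x hx y hy
    have hd0 : 0 ≤ d := (norm_nonneg _).trans (hd x hx y hy)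
    set c : ℝ → E := fun s => (1 - s) • x + s • y
    have hc : Continuous c := by fun_prop
    have hcK : ∀ s ∈ Icc (0 : ℝ) 1, c s ∈ K := fun s hs =>
      hK hx hy (by linarith [hs.2]) hs.1 (by ring)
    have hcd : ∀ s, HasDerivAt c (y - x) s := fun s => by
      have h1 : HasDerivAt (fun s : ℝ => (1 - s) • x) ((-1 : ℝ) • x) s :=
        ((hasDerivAt_id s).const_sub 1).smul_const x
      have h2 : HasDerivAt (fun s : ℝ => s • y) ((1 : ℝ) • y) s :=
        (hasDerivAt_id s).smul_const y
      have h3 := h1.add h2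
      have e : (-1 : ℝ) • x + (1 : ℝ) • y = y - x := by
        rw [neg_one_smul, one_smul, neg_add_eq_sub]
      rw [e] at h3
      exact h3
    have hFc : ∀ s ∈ Ioo (0 : ℝ) 1 ∩ c ⁻¹' O,
        HasDerivAt (F ∘ c) (fderiv ℝ F (c s) (y - x)) s := fun s hs =>
      (hFd _ ⟨hcK s (Ioo_subset_Icc_self hs.1), hs.2⟩).hasFDerivAt.comp_hasDerivAt s (hcd s)
    have h1 : ‖(F ∘ c) 1 - (F ∘ c) 0‖ₑ ≤
        ∫⁻ s in Ioo 0 1 ∩ c ⁻¹' O, ‖deriv (F ∘ c) s‖ₑ :=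
      enorm_sub_le_lintegral_deriv_inter (hF.comp hc.continuousOn hcK) (hO.preimage hc)
        (fun s hs => (hFc s hs).differentiableAt)
        (fun s hs hsO => hF0 _ (hcK s hs) hsO)
    have hmS : MeasurableSet (Ioo (0 : ℝ) 1 ∩ c ⁻¹' O) :=
      measurableSet_Ioo.inter (hO.preimage hc).measurableSet
    have h2 : ‖F y - F x‖ₑ ≤
        ∫⁻ s in Ioo 0 1 ∩ c ⁻¹' O, ENNReal.ofReal d * ‖fderiv ℝ F (c s)‖ₑ := by
      have e : ‖(F ∘ c) 1 - (F ∘ c) 0‖ₑ = ‖F y - F x‖ₑ := by simp [c]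
      rw [← e]
      refine h1.trans (setLIntegral_mono' hmS fun s hs => ?_)
      rw [(hFc s hs).deriv, mul_comm]
      refine (ContinuousLinearMap.le_opENorm _ _).trans ?_
      gcongr
      rw [← ofReal_norm]
      exact ENNReal.ofReal_le_ofReal (hd x hx y hy)
    have hmeas : Measurable fun s => ENNReal.ofReal d * ‖fderiv ℝ F (c s)‖ₑ :=
      (((measurable_fderiv ℝ F).comp hc.measurable).enorm).const_mul _
    calc ‖F y - F x‖ₑ ^ 2
        ≤ (∫⁻ s in Ioo 0 1 ∩ c ⁻¹' O, ENNReal.ofReal d * ‖fderiv ℝ F (c s)‖ₑ) ^ 2 := by gcongr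
      _ ≤ ∫⁻ s in Ioo 0 1 ∩ c ⁻¹' O, (ENNReal.ofReal d * ‖fderiv ℝ F (c s)‖ₑ) ^ 2 := by
          refine lintegral_sq_le_of_measure_le_one ?_ hmeas.aemeasurable
          rw [Measure.restrict_apply_univ]
          exact (measure_mono inter_subset_left).trans (by simp)
      _ = ∫⁻ s in Ioo 0 1 ∩ c ⁻¹' O, ENNReal.ofReal (d ^ 2) * h (c s) := by
          refine setLIntegral_congr_fun hmS fun s hs => ?_
          have : c s ∈ K ∩ O := ⟨hcK s (Ioo_subset_Icc_self hs.1), hs.2⟩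
          simp only [hh, indicator_of_mem this, mul_pow, ENNReal.ofReal_pow hd0]
      _ ≤ ∫⁻ s in Ioo (0 : ℝ) 1, ENNReal.ofReal (d ^ 2) * h (c s) :=
          lintegral_mono_set inter_subset_left
      _ = _ := lintegral_const_mul _ (hm.comp hc.measurable)
  -- One of `s` and `1 - s` is at least `1/2`. Integrating first in the variable that carries this
  -- coefficient, the change of variables costs a factor of at most `2 ^ dim E`, and the other
  -- integration contributes `μ K`.
  have slice : ∀ s ∈ Ioo (0 : ℝ) 1,
      ∫⁻ x in K, ∫⁻ y in K, h ((1 - s) • x + s • y) ∂μ ∂μ ≤ ENNReal.ofReal N * μ K * J := by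
    intro s hs
    have hfac : ∀ r : ℝ, 1 / 2 ≤ r → ∀ w : E, ∫⁻ x in K, h (r • x + w) ∂μ ≤
        ENNReal.ofReal N * J := by
      intro r hr w
      refine (setLIntegral_le_lintegral _ _).trans ?_
      rw [lintegral_comp_smul_add μ hm (by linarith) w]
      gcongr
      rw [abs_of_nonneg (by positivity), ← inv_pow]
      refine pow_le_pow_left₀ (by positivity) ?_ _
      rw [inv_le_comm₀ (by linarith) (by norm_num)]
      linarith
    have hconst : ∫⁻ _ in K, ENNReal.ofReal N * J ∂μ = ENNReal.ofReal N * μ K * J := by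
      rw [setLIntegral_const]; ring
    rcases le_total (1 / 2) s with h2 | h2
    · rw [← hconst]
      refine lintegral_mono fun x => ?_
      simp_rw [add_comm ((1 - s) • x)]
      exact hfac s h2 _
    · rw [lintegral_lintegral_swap]
      · rw [← hconst]
        refine lintegral_mono fun y => ?_
        exact hfac (1 - s) (by linarith) _
      · refine (hm.comp ?_).aemeasurable
        exact (measurable_fst.const_smul (1 - s)).add (measurable_snd.const_smul s)
  have hm3' : ∀ x, Measurable fun p : E × ℝ => h ((1 - p.2) • x + p.2 • p.1) := fun x =>
    hm.comp (Continuous.measurable (by fun_prop))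
  have hm4 : Measurable fun p : E × ℝ => ∫⁻ y in K, h ((1 - p.2) • p.1 + p.2 • y) ∂μ := by
    refine Measurable.lintegral_prod_right' (f := fun q : (E × ℝ) × E =>
      h ((1 - q.1.2) • q.1.1 + q.1.2 • q.2)) ?_
    exact hm.comp (Continuous.measurable (by fun_prop))
  rw [hJ']
  calc ∫⁻ x in K, ∫⁻ y in K, ‖F y - F x‖ₑ ^ 2 ∂μ ∂μ
      ≤ ∫⁻ x in K, ∫⁻ y in K, (ENNReal.ofReal (d ^ 2) *
          ∫⁻ s in Ioo (0 : ℝ) 1, h ((1 - s) • x + s • y)) ∂μ ∂μ :=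
        setLIntegral_mono' hKm fun x hx => setLIntegral_mono' hKm fun y hy => key x hx y hy
    _ = ENNReal.ofReal (d ^ 2) * ∫⁻ x in K, ∫⁻ y in K,
          (∫⁻ s in Ioo (0 : ℝ) 1, h ((1 - s) • x + s • y)) ∂μ ∂μ := by
        rw [← lintegral_const_mul' _ _ ENNReal.ofReal_ne_top]
        simp_rw [lintegral_const_mul' _ _ ENNReal.ofReal_ne_top]
    _ = ENNReal.ofReal (d ^ 2) * ∫⁻ s in Ioo (0 : ℝ) 1, ∫⁻ x in K, ∫⁻ y in K,
          h ((1 - s) • x + s • y) ∂μ ∂μ := by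
        congr 1
        rw [lintegral_lintegral_swap (f := fun s x => ∫⁻ y in K, h ((1 - s) • x + s • y) ∂μ)
          (hm4.comp measurable_swap).aemeasurable]
        refine lintegral_congr fun x => ?_
        exact lintegral_lintegral_swap (hm3' x).aemeasurable
    _ ≤ ENNReal.ofReal (d ^ 2) * ∫⁻ s in Ioo (0 : ℝ) 1, ENNReal.ofReal N * μ K * J := by
        gcongr 1
        exact setLIntegral_mono' measurableSet_Ioo slice
    _ = ENNReal.ofReal (N * d ^ 2) * μ K * J := by
        rw [setLIntegral_const, Real.volume_Ioo, ENNReal.ofReal_mul (by positivity)]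
        simp only [sub_zero, ENNReal.ofReal_one, mul_one]
        ring

end Poincare

namespace ImmersedHypersurface

/-! ### Behaviour of the metric and the second derivatives under a change of chart -/

section Transition

variable {n : ℕ} {M : Type*} [TopologicalSpace M] [ChartedSpace (EuclideanSpace ℝ (Fin n)) M]
  (γ : ImmersedHypersurface n M)

/-- The Jacobian matrix of a map of `ℝⁿ`. -/
noncomputable def jacobian (τ : EuclideanSpace ℝ (Fin n) → EuclideanSpace ℝ (Fin n))
    (y : EuclideanSpace ℝ (Fin n)) : Matrix (Fin n) (Fin n) ℝ :=
  Matrix.of fun k i => fderiv ℝ τ y (EuclideanSpace.single i 1) k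

theorem det_jacobian (τ : EuclideanSpace ℝ (Fin n) → EuclideanSpace ℝ (Fin n))
    (y : EuclideanSpace ℝ (Fin n)) : (jacobian τ y).det = (fderiv ℝ τ y).det := by
  have : jacobian τ y = LinearMap.toMatrix (EuclideanSpace.basisFun (Fin n) ℝ).toBasis
      (EuclideanSpace.basisFun (Fin n) ℝ).toBasis (fderiv ℝ τ y).toLinearMap := by
    ext k i
    simp [jacobian, LinearMap.toMatrix_apply]
  rw [this, LinearMap.det_toMatrix]

theorem apply_eq_sum_single {F : Type*} [NormedAddCommGroup F] [NormedSpace ℝ F]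
    (A : EuclideanSpace ℝ (Fin n) →L[ℝ] F) (v : EuclideanSpace ℝ (Fin n)) :
    A v = ∑ k, v k • A (EuclideanSpace.single k 1) := by
  conv_lhs => rw [← (EuclideanSpace.basisFun (Fin n) ℝ).sum_repr v]
  simp [map_sum]

variable {φ ψ : OpenPartialHomeomorph M (EuclideanSpace ℝ (Fin n))}

theorem contDiffAt_param (hφ : φ ∈ IsManifold.maximalAtlas (𝓡 n) ∞ M)
    {y : EuclideanSpace ℝ (Fin n)} (hy : y ∈ φ.target) :
    ContDiffAt ℝ ∞ (γ.toFun ∘ φ.symm) y :=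
  (γ.contDiffOn_param hφ).contDiffAt (φ.open_target.mem_nhds hy)

theorem contDiffAt_coordVec (hφ : φ ∈ IsManifold.maximalAtlas (𝓡 n) ∞ M)
    {y : EuclideanSpace ℝ (Fin n)} (hy : y ∈ φ.target) (i : Fin n) :
    ContDiffAt ℝ ∞ (γ.coordVec φ i) y :=
  ((γ.contDiffAt_param hφ hy).fderiv_right (m := ∞) (by simp)).clm_apply contDiffAt_const

theorem continuousOn_coordHess (hφ : φ ∈ IsManifold.maximalAtlas (𝓡 n) ∞ M) (i j : Fin n) :
    ContinuousOn (γ.coordHess φ i j) φ.target := fun _ hy =>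
  (((γ.contDiffAt_coordVec hφ hy j).fderiv_right (m := 0) (by simp)).clm_apply
    contDiffAt_const).continuousAt.continuousWithinAt

theorem contDiffAt_transition (hφ : φ ∈ IsManifold.maximalAtlas (𝓡 n) ∞ M)
    (hψ : ψ ∈ IsManifold.maximalAtlas (𝓡 n) ∞ M) {y : EuclideanSpace ℝ (Fin n)}
    (hy : y ∈ ψ.target) (hy' : ψ.symm y ∈ φ.source) : ContDiffAt ℝ ∞ (φ ∘ ψ.symm) y := by
  rw [← contMDiffAt_iff_contDiffAt]
  exact ((contMDiffOn_of_mem_maximalAtlas hφ).contMDiffAt (φ.open_source.mem_nhds hy')).comp y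
    ((contMDiffOn_symm_of_mem_maximalAtlas hψ).contMDiffAt (ψ.open_target.mem_nhds hy))

theorem eventually_mem_transition {M : Type*} [TopologicalSpace M]
    {φ ψ : OpenPartialHomeomorph M (EuclideanSpace ℝ (Fin n))} {y : EuclideanSpace ℝ (Fin n)}
    (hy : y ∈ ψ.target) (hy' : ψ.symm y ∈ φ.source) :
    ∀ᶠ z in nhds y, z ∈ ψ.target ∧ ψ.symm z ∈ φ.source :=
  (ψ.open_target.eventually_mem hy).and
    ((ψ.continuousAt_symm hy).eventually (φ.open_source.eventually_mem hy'))

theorem coordVec_transition (hφ : φ ∈ IsManifold.maximalAtlas (𝓡 n) ∞ M)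
    (hψ : ψ ∈ IsManifold.maximalAtlas (𝓡 n) ∞ M) {y : EuclideanSpace ℝ (Fin n)}
    (hy : y ∈ ψ.target) (hy' : ψ.symm y ∈ φ.source) (i : Fin n) :
    γ.coordVec ψ i y =
      ∑ k, jacobian (φ ∘ ψ.symm) y k i • γ.coordVec φ k ((φ ∘ ψ.symm) y) := by
  have he : γ.toFun ∘ ψ.symm =ᶠ[nhds y] (γ.toFun ∘ φ.symm) ∘ (φ ∘ ψ.symm) := by
    filter_upwards [eventually_mem_transition hy hy'] with z hz
    simp [φ.left_inv hz.2]
  have h1 := (γ.contDiffAt_param hφ (φ.map_source hy')).differentiableAt (by simp)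
  have h2 := (contDiffAt_transition hφ hψ hy hy').differentiableAt (by simp)
  rw [coordVec, he.fderiv_eq, fderiv_comp y h1 h2, ContinuousLinearMap.comp_apply,
    apply_eq_sum_single]
  rfl

theorem metricMatrix_transition (hφ : φ ∈ IsManifold.maximalAtlas (𝓡 n) ∞ M)
    (hψ : ψ ∈ IsManifold.maximalAtlas (𝓡 n) ∞ M) {y : EuclideanSpace ℝ (Fin n)}
    (hy : y ∈ ψ.target) (hy' : ψ.symm y ∈ φ.source) :
    γ.metricMatrix ψ y = (jacobian (φ ∘ ψ.symm) y).transpose *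
      γ.metricMatrix φ ((φ ∘ ψ.symm) y) * jacobian (φ ∘ ψ.symm) y := by
  ext i j
  rw [Matrix.mul_assoc]
  simp only [metricMatrix, Matrix.gram_apply, γ.coordVec_transition hφ hψ hy hy',
    Matrix.mul_apply, Matrix.transpose_apply, sum_inner, inner_sum, real_inner_smul_left,
    real_inner_smul_right, Finset.mul_sum]
  rw [Finset.sum_comm]
  refine Finset.sum_congr rfl fun k _ => Finset.sum_congr rfl fun l _ => ?_
  ring

/-- Differentiating the chain rule once more also produces second derivatives of the transition map,
but they multiply coordinate vectors, which are orthogonal to `N`. Only the tensorial term survives.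
-/
theorem coordHess_transition (hφ : φ ∈ IsManifold.maximalAtlas (𝓡 n) ∞ M)
    (hψ : ψ ∈ IsManifold.maximalAtlas (𝓡 n) ∞ M) {y : EuclideanSpace ℝ (Fin n)}
    (hy : y ∈ ψ.target) (hy' : ψ.symm y ∈ φ.source) {N : EuclideanSpace ℝ (Fin (n + 1))}
    (hN : ∀ k, inner ℝ (γ.coordVec φ k ((φ ∘ ψ.symm) y)) N = 0) :
    (Matrix.of fun i j => inner ℝ (γ.coordHess ψ i j y) N) =
      (jacobian (φ ∘ ψ.symm) y).transpose *
        (Matrix.of fun i j => inner ℝ (γ.coordHess φ i j ((φ ∘ ψ.symm) y)) N) *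
        jacobian (φ ∘ ψ.symm) y := by
  set τ := φ ∘ ψ.symm with hτ
  have hτd := contDiffAt_transition hφ hψ hy hy'
  ext i j
  have he : γ.coordVec ψ j =ᶠ[nhds y] fun z => ∑ k, jacobian τ z k j • γ.coordVec φ k (τ z) := by
    filter_upwards [eventually_mem_transition hy hy'] with z hz
    exact γ.coordVec_transition hφ hψ hz.1 hz.2 j
  have hJ : ∀ k, DifferentiableAt ℝ (fun z => jacobian τ z k j) y := fun k => by
    have h : ContDiffAt ℝ ∞ (fun z => fderiv ℝ τ z (EuclideanSpace.single j 1)) y :=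
      (hτd.fderiv_right (m := ∞) (by simp)).clm_apply contDiffAt_const
    exact ((EuclideanSpace.proj k : EuclideanSpace ℝ (Fin n) →L[ℝ] ℝ).differentiableAt).comp y
      (h.differentiableAt (by simp))
  have hV : ∀ k, DifferentiableAt ℝ (γ.coordVec φ k) (τ y) := fun k =>
    (γ.contDiffAt_coordVec hφ (φ.map_source hy') k).differentiableAt (by simp)
  have hτd' := hτd.differentiableAt (by simp)
  have hd : HasFDerivAt (fun z => ∑ k, jacobian τ z k j • γ.coordVec φ k (τ z))
      (∑ k, (jacobian τ y k j • (fderiv ℝ (γ.coordVec φ k) (τ y)).comp (fderiv ℝ τ y) +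
        (fderiv ℝ (fun z => jacobian τ z k j) y).smulRight (γ.coordVec φ k (τ y)))) y :=
    HasFDerivAt.fun_sum fun k _ =>
      (hJ k).hasFDerivAt.smul ((hV k).hasFDerivAt.comp y hτd'.hasFDerivAt)
  have h1 : γ.coordHess ψ i j y = ∑ k, (jacobian τ y k j • ∑ l, jacobian τ y l i •
      γ.coordHess φ l k (τ y) + (fderiv ℝ (fun z => jacobian τ z k j) y
        (EuclideanSpace.single i 1)) • γ.coordVec φ k (τ y)) := by
    rw [coordHess, he.fderiv_eq, hd.fderiv]
    simp only [sum_apply, add_apply,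
      smul_apply, ContinuousLinearMap.comp_apply,
      ContinuousLinearMap.smulRight_apply]
    refine Finset.sum_congr rfl fun k _ => ?_
    rw [apply_eq_sum_single (fderiv ℝ (γ.coordVec φ k) (τ y))]
    rfl
  simp only [Matrix.of_apply, h1, Matrix.mul_apply, Matrix.transpose_apply, sum_inner,
    inner_add_left, real_inner_smul_left, hN, mul_zero, add_zero, Finset.sum_mul, Finset.mul_sum]
  refine Finset.sum_congr rfl fun k _ => Finset.sum_congr rfl fun l _ => ?_
  ring

/-- The factor that appears is the Jacobian of the change of variables formula, which is why the
area densities of two charts define one measure. -/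
theorem sqrt_det_metricMatrix_transition (hφ : φ ∈ IsManifold.maximalAtlas (𝓡 n) ∞ M)
    (hψ : ψ ∈ IsManifold.maximalAtlas (𝓡 n) ∞ M) {y : EuclideanSpace ℝ (Fin n)}
    (hy : y ∈ ψ.target) (hy' : ψ.symm y ∈ φ.source) :
    Real.sqrt (γ.metricMatrix ψ y).det = |(fderiv ℝ (φ ∘ ψ.symm) y).det| *
      Real.sqrt (γ.metricMatrix φ ((φ ∘ ψ.symm) y)).det := by
  rw [γ.metricMatrix_transition hφ hψ hy hy', Matrix.det_mul, Matrix.det_mul,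
    Matrix.det_transpose, det_jacobian]
  rw [mul_assoc, mul_comm (Matrix.det _), ← mul_assoc, ← sq, Real.sqrt_mul (sq_nonneg _),
    Real.sqrt_sq_eq_abs]

theorem continuousOn_sqrt_det (hφ : φ ∈ IsManifold.maximalAtlas (𝓡 n) ∞ M) :
    ContinuousOn (fun y => Real.sqrt (γ.metricMatrix φ y).det) φ.target := by
  refine Real.continuous_sqrt.comp_continuousOn ?_
  have : ContinuousOn (fun y => γ.metricMatrix φ y) φ.target := by
    refine continuousOn_pi.mpr fun i => continuousOn_pi.mpr fun j => ?_
    exact (γ.continuousOn_coordVec hφ i).inner (γ.continuousOn_coordVec hφ j)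
  exact (Continuous.matrix_det continuous_id).comp_continuousOn this

theorem aemeasurable_density (hφ : φ ∈ IsManifold.maximalAtlas (𝓡 n) ∞ M) :
    AEMeasurable (fun y => ENNReal.ofReal (Real.sqrt (γ.metricMatrix φ y).det))
      (volume.restrict φ.target) :=
  ((γ.continuousOn_sqrt_det hφ).aemeasurable φ.open_target.measurableSet).ennreal_ofReal

end Transition

/-! ### The area measure in charts -/

section Area

variable {n : ℕ} {M : Type*} [TopologicalSpace M] [ChartedSpace (EuclideanSpace ℝ (Fin n)) M]
  [MeasurableSpace M] [BorelSpace M] (γ : ImmersedHypersurface n M)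
  {φ ψ : OpenPartialHomeomorph M (EuclideanSpace ℝ (Fin n))}

theorem aemeasurable_symm :
    AEMeasurable φ.symm ((volume.restrict φ.target).withDensity
      fun y => ENNReal.ofReal (Real.sqrt (γ.metricMatrix φ y).det)) :=
  (φ.continuousOn_symm.aemeasurable φ.open_target.measurableSet).mono_ac
    (withDensity_absolutelyContinuous _ _)

theorem measurableSet_target_inter {M : Type*} [TopologicalSpace M] [MeasurableSpace M]
    [BorelSpace M] (φ : OpenPartialHomeomorph M (EuclideanSpace ℝ (Fin n)))
    {S : Set M} (hS : MeasurableSet S) : MeasurableSet (φ.target ∩ φ.symm ⁻¹' S) := by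
  have h : Measurable (φ.target.domRestrict φ.symm) :=
    (continuousOn_iff_continuous_domRestrict.mp φ.continuousOn_symm).measurable
  have := φ.open_target.measurableSet.subtype_image (h hS)
  convert this using 1
  ext y
  exact ⟨fun hy => ⟨⟨y, hy.1⟩, hy.2, rfl⟩, fun ⟨z, hz, hzy⟩ => hzy ▸ ⟨z.2, hz⟩⟩

theorem lintegral_chartArea (hφ : φ ∈ IsManifold.maximalAtlas (𝓡 n) ∞ M) {S : Set M}
    (hS : MeasurableSet S) {G : M → ENNReal} (hG : Measurable G) :
    ∫⁻ p in S, G p ∂γ.chartArea φ = ∫⁻ y in φ.target ∩ φ.symm ⁻¹' S,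
      ENNReal.ofReal (Real.sqrt (γ.metricMatrix φ y).det) * G (φ.symm y) := by
  have hm : AEMeasurable (fun y => S.indicator G (φ.symm y)) (volume.restrict φ.target) :=
    (hG.indicator hS).comp_aemeasurable
      (φ.continuousOn_symm.aemeasurable φ.open_target.measurableSet)
  rw [← lintegral_indicator hS, chartArea,
    lintegral_map' (hG.indicator hS).aemeasurable γ.aemeasurable_symm,
    lintegral_withDensity_eq_lintegral_mul₀ (γ.aemeasurable_density hφ) hm,
    ← lintegral_indicator φ.open_target.measurableSet,
    ← lintegral_indicator (measurableSet_target_inter φ hS)]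
  refine lintegral_congr fun y => ?_
  by_cases h1 : y ∈ φ.target <;> by_cases h2 : φ.symm y ∈ S <;> simp [h1, h2]

theorem chartArea_apply (hφ : φ ∈ IsManifold.maximalAtlas (𝓡 n) ∞ M) {S : Set M}
    (hS : MeasurableSet S) :
    γ.chartArea φ S = ∫⁻ y in φ.target ∩ φ.symm ⁻¹' S,
      ENNReal.ofReal (Real.sqrt (γ.metricMatrix φ y).det) := by
  have := γ.lintegral_chartArea hφ hS (measurable_const (a := (1 : ENNReal)))
  simpa using this

/-- The area measures given by two charts agree on the overlap. -/
theorem chartArea_eq_of_subset (hφ : φ ∈ IsManifold.maximalAtlas (𝓡 n) ∞ M)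
    (hψ : ψ ∈ IsManifold.maximalAtlas (𝓡 n) ∞ M) {S : Set M} (hS : MeasurableSet S)
    (hSφ : S ⊆ φ.source) (hSψ : S ⊆ ψ.source) : γ.chartArea ψ S = γ.chartArea φ S := by
  rw [γ.chartArea_apply hφ hS, γ.chartArea_apply hψ hS]
  set A := ψ.target ∩ ψ.symm ⁻¹' S
  have himg : φ.target ∩ φ.symm ⁻¹' S = (φ ∘ ψ.symm) '' A := by
    ext z
    constructor
    · rintro ⟨hz, hzS⟩
      refine ⟨ψ (φ.symm z), ⟨ψ.map_source (hSψ hzS), ?_⟩, ?_⟩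
      · rw [mem_preimage, ψ.left_inv (hSψ hzS)]; exact hzS
      · simp [ψ.left_inv (hSψ hzS), φ.right_inv hz]
    · rintro ⟨y, ⟨hy, hyS⟩, rfl⟩
      refine ⟨φ.map_source (hSφ hyS), ?_⟩
      simpa [φ.left_inv (hSφ hyS)] using hyS
  have hinj : InjOn (φ ∘ ψ.symm) A := by
    rintro y ⟨hy, hyS⟩ z ⟨hz, hzS⟩ h
    exact ψ.symm.injOn hy hz (φ.injOn (hSφ hyS) (hSφ hzS) h)
  -- Change of variables along the transition map; its Jacobian is absorbed by the transformation
  -- rule of `√(det g)`.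
  rw [himg, lintegral_image_eq_lintegral_abs_det_fderiv_mul volume
    (measurableSet_target_inter ψ hS) (fun y hy =>
      ((contDiffAt_transition hφ hψ hy.1 (hSφ hy.2)).differentiableAt
        (by simp)).hasFDerivAt.hasFDerivWithinAt) hinj]
  refine setLIntegral_congr_fun (measurableSet_target_inter ψ hS) fun y hy => ?_
  rw [γ.sqrt_det_metricMatrix_transition hφ hψ hy.1 (hSφ hy.2),
    ENNReal.ofReal_mul (abs_nonneg _)]

theorem chartArea_compl_source (hφ : φ ∈ IsManifold.maximalAtlas (𝓡 n) ∞ M) :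
    γ.chartArea φ φ.sourceᶜ = 0 := by
  rw [γ.chartArea_apply hφ φ.open_source.measurableSet.compl]
  have : φ.target ∩ φ.symm ⁻¹' φ.sourceᶜ = ∅ := by
    ext y
    simp only [mem_inter_iff, mem_preimage, mem_compl_iff, mem_empty_iff_false, iff_false,
      not_and, not_not]
    exact fun hy => φ.map_target hy
  rw [this, Measure.restrict_empty, lintegral_zero_measure]

/-- In the domain of a chart, the area measure is the one given by the chart. -/
theorem area_restrict_source (hφ : φ ∈ IsManifold.maximalAtlas (𝓡 n) ∞ M) :
    γ.area.restrict φ.source = γ.chartArea φ := by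
  have hs := φ.open_source.measurableSet
  have hle : ∀ ψ ∈ IsManifold.maximalAtlas (𝓡 n) ∞ M, γ.chartArea ψ ≤ γ.area := fun ψ hψ =>
    le_iSup₂ (f := fun φ (_ : φ ∈ IsManifold.maximalAtlas (𝓡 n) ∞ M) => γ.chartArea φ) ψ hψ
  have hr : (γ.chartArea φ).restrict φ.source = γ.chartArea φ :=
    Measure.restrict_eq_self_of_ae_mem (by
      rw [ae_iff]; exact γ.chartArea_compl_source hφ)
  refine le_antisymm ?_ (hr ▸ Measure.restrict_mono_measure (hle φ hφ) _)
  -- The area is a least upper bound, so it suffices to show that the measure on the right dominates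
  -- every chart measure. Inside `φ.source` this is the agreement on overlaps; outside it is the
  -- definition of the area.
  have hup : γ.area ≤ γ.chartArea φ + γ.area.restrict φ.sourceᶜ := by
    refine iSup₂_le fun ψ hψ => Measure.le_iff.mpr fun S hS => ?_
    have h0 : γ.chartArea ψ ψ.sourceᶜ = 0 := γ.chartArea_compl_source hψ
    have h1 : γ.chartArea ψ (S ∩ φ.source) ≤ γ.chartArea φ S := by
      calc γ.chartArea ψ (S ∩ φ.source)
          ≤ γ.chartArea ψ (S ∩ φ.source ∩ ψ.source ∪ ψ.sourceᶜ) := by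
            refine measure_mono fun p hp => ?_
            by_cases h : p ∈ ψ.source
            · exact Or.inl ⟨hp, h⟩
            · exact Or.inr h
        _ ≤ γ.chartArea ψ (S ∩ φ.source ∩ ψ.source) + γ.chartArea ψ ψ.sourceᶜ :=
            measure_union_le _ _
        _ = γ.chartArea φ (S ∩ φ.source ∩ ψ.source) := by
            rw [h0, add_zero]
            exact γ.chartArea_eq_of_subset hφ hψ
              ((hS.inter hs).inter ψ.open_source.measurableSet)
              (inter_subset_left.trans inter_subset_right) inter_subset_right
        _ ≤ γ.chartArea φ S := measure_mono (inter_subset_left.trans inter_subset_left)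
    calc γ.chartArea ψ S = γ.chartArea ψ (S ∩ φ.source) + γ.chartArea ψ (S \ φ.source) :=
          (measure_inter_add_sdiff S hs).symm
      _ ≤ γ.chartArea φ S + γ.area (S \ φ.source) := add_le_add h1 (hle ψ hψ _)
      _ = _ := by
          rw [Measure.add_apply, Measure.restrict_apply hS]; rfl
  refine Measure.le_iff.mpr fun S hS => ?_
  rw [Measure.restrict_apply hS]
  refine (hup _).trans ?_
  rw [Measure.add_apply, Measure.restrict_apply (hS.inter hs)]
  have : S ∩ φ.source ∩ φ.sourceᶜ = ∅ := by
    rw [inter_assoc, inter_compl_self, inter_empty]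
  rw [this, measure_empty, add_zero]
  exact measure_mono inter_subset_left

theorem lintegral_area (hφ : φ ∈ IsManifold.maximalAtlas (𝓡 n) ∞ M) {S : Set M}
    (hS : MeasurableSet S) (hSφ : S ⊆ φ.source) {G : M → ENNReal} (hG : Measurable G) :
    ∫⁻ p in S, G p ∂γ.area = ∫⁻ y in φ.target ∩ φ.symm ⁻¹' S,
      ENNReal.ofReal (Real.sqrt (γ.metricMatrix φ y).det) * G (φ.symm y) := by
  rw [← γ.lintegral_chartArea hφ hS hG, ← γ.area_restrict_source hφ,
    Measure.restrict_restrict hS, inter_eq_left.mpr hSφ]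

theorem area_apply (hφ : φ ∈ IsManifold.maximalAtlas (𝓡 n) ∞ M) {S : Set M}
    (hS : MeasurableSet S) (hSφ : S ⊆ φ.source) :
    γ.area S = ∫⁻ y in φ.target ∩ φ.symm ⁻¹' S,
      ENNReal.ofReal (Real.sqrt (γ.metricMatrix φ y).det) := by
  rw [← γ.chartArea_apply hφ hS, ← γ.area_restrict_source hφ, Measure.restrict_apply hS,
    inter_eq_left.mpr hSφ]

theorem area_image_lt_top [T2Space M] (hφ : φ ∈ IsManifold.maximalAtlas (𝓡 n) ∞ M)
    {K : Set (EuclideanSpace ℝ (Fin n))} (hK : IsCompact K) (hKφ : K ⊆ φ.target) :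
    γ.area (φ.symm '' K) < ⊤ := by
  have hc : IsCompact (φ.symm '' K) := hK.image_of_continuousOn (φ.continuousOn_symm.mono hKφ)
  have hsub : φ.symm '' K ⊆ φ.source := by
    rintro _ ⟨y, hy, rfl⟩
    exact φ.map_target (hKφ hy)
  have he : φ.target ∩ φ.symm ⁻¹' (φ.symm '' K) = K := by
    ext y
    constructor
    · rintro ⟨hy, z, hz, hzy⟩
      exact φ.symm.injOn (hKφ hz) hy hzy ▸ hz
    · exact fun hy => ⟨hKφ hy, y, hy, rfl⟩
  rw [γ.area_apply hφ hc.measurableSet hsub, he]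
  obtain ⟨C, hC⟩ := hK.exists_bound_of_continuousOn ((γ.continuousOn_sqrt_det hφ).mono hKφ)
  calc ∫⁻ y in K, ENNReal.ofReal (Real.sqrt (γ.metricMatrix φ y).det)
      ≤ ∫⁻ _ in K, ENNReal.ofReal C :=
        setLIntegral_mono' hK.measurableSet fun y hy =>
          ENNReal.ofReal_le_ofReal ((le_abs_self _).trans (hC y hy))
    _ = ENNReal.ofReal C * volume K := setLIntegral_const _ _
    _ < ⊤ := ENNReal.mul_lt_top ENNReal.ofReal_lt_top hK.measure_lt_top

theorem area_lt_top_of_isCompact [T2Space M] [IsManifold (𝓡 n) ∞ M] {K : Set M}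
    (hK : IsCompact K) : γ.area K < ⊤ := by
  refine hK.measure_lt_top_of_nhdsWithin fun p _ => ?_
  set φ := chartAt (EuclideanSpace ℝ (Fin n)) p
  have hφ : φ ∈ IsManifold.maximalAtlas (𝓡 n) ∞ M := IsManifold.chart_mem_maximalAtlas p
  have hp : p ∈ φ.source := mem_chart_source _ p
  obtain ⟨r, hr, hrφ⟩ := Metric.nhds_basis_closedBall.mem_iff.mp
    (φ.open_target.mem_nhds (φ.map_source hp))
  refine ⟨φ.symm '' Metric.closedBall (φ p) r, ?_,
    γ.area_image_lt_top hφ (isCompact_closedBall _ _) hrφ⟩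
  refine nhdsWithin_le_nhds ?_
  have := φ.symm.image_mem_nhds (φ.map_source hp) (Metric.closedBall_mem_nhds (φ p) hr)
  rwa [φ.left_inv hp] at this

end Area

/-! ### Chart independence and continuity of `|B|²` -/

section Curvature

variable {n : ℕ} {M : Type*} [TopologicalSpace M] [ChartedSpace (EuclideanSpace ℝ (Fin n)) M]
  (γ : ImmersedHypersurface n M)
  {φ ψ : OpenPartialHomeomorph M (EuclideanSpace ℝ (Fin n))}

/-- The matrix `g⁻¹ ⟨∂ᵢ∂ⱼX, N⟩` at the point with coordinate `y` in the chart `φ`. -/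
noncomputable def shapeMatrixIn (φ : OpenPartialHomeomorph M (EuclideanSpace ℝ (Fin n)))
    (y : EuclideanSpace ℝ (Fin n)) (N : EuclideanSpace ℝ (Fin (n + 1))) :
    Matrix (Fin n) (Fin n) ℝ :=
  (γ.metricMatrix φ y)⁻¹ * Matrix.of fun i j => inner ℝ (γ.coordHess φ i j y) N

/-- With `g` and `h` both transforming as `Jᵀ · J`, the matrix `g⁻¹ h` is conjugated by `J`, and the
trace of its square is a conjugation invariant. -/
theorem trace_shapeMatrixIn_transition (hφ : φ ∈ IsManifold.maximalAtlas (𝓡 n) ∞ M)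
    (hψ : ψ ∈ IsManifold.maximalAtlas (𝓡 n) ∞ M) {y : EuclideanSpace ℝ (Fin n)}
    (hy : y ∈ ψ.target) (hy' : ψ.symm y ∈ φ.source) {N : EuclideanSpace ℝ (Fin (n + 1))}
    (hN : ∀ k, inner ℝ (γ.coordVec φ k ((φ ∘ ψ.symm) y)) N = 0) :
    (γ.shapeMatrixIn ψ y N * γ.shapeMatrixIn ψ y N).trace =
      (γ.shapeMatrixIn φ ((φ ∘ ψ.symm) y) N * γ.shapeMatrixIn φ ((φ ∘ ψ.symm) y) N).trace := by
  have hg := γ.metricMatrix_transition hφ hψ hy hy'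
  have hdet := γ.det_metricMatrix_pos hψ hy
  set J := jacobian (φ ∘ ψ.symm) y
  have hJ : IsUnit J.det := by
    refine isUnit_iff_ne_zero.mpr fun h => ?_
    rw [hg, Matrix.det_mul, h, mul_zero] at hdet
    exact lt_irrefl _ hdet
  have hJt : IsUnit J.transpose.det := by rwa [Matrix.det_transpose]
  have hS : γ.shapeMatrixIn ψ y N = J⁻¹ * γ.shapeMatrixIn φ ((φ ∘ ψ.symm) y) N * J := by
    rw [shapeMatrixIn, γ.coordHess_transition hφ hψ hy hy' hN, hg, Matrix.mul_inv_rev,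
      Matrix.mul_inv_rev, shapeMatrixIn]
    simp only [Matrix.mul_assoc]
    rw [← Matrix.mul_assoc J.transpose⁻¹ J.transpose, Matrix.nonsing_inv_mul _ hJt,
      Matrix.one_mul]
  rw [hS]
  have : J⁻¹ * γ.shapeMatrixIn φ ((φ ∘ ψ.symm) y) N * J *
      (J⁻¹ * γ.shapeMatrixIn φ ((φ ∘ ψ.symm) y) N * J) =
      J⁻¹ * (γ.shapeMatrixIn φ ((φ ∘ ψ.symm) y) N * γ.shapeMatrixIn φ ((φ ∘ ψ.symm) y) N * J) := by
    simp only [Matrix.mul_assoc]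
    rw [← Matrix.mul_assoc J J⁻¹, Matrix.mul_nonsing_inv _ hJ, Matrix.one_mul]
  rw [this, Matrix.trace_mul_comm, Matrix.mul_assoc, Matrix.mul_nonsing_inv _ hJ, Matrix.mul_one]

/-- The tangent plane is spanned by the coordinate vectors. -/
theorem tangentPlane_eq_span (hφ : φ ∈ IsManifold.maximalAtlas (𝓡 n) ∞ M) {p : M}
    (hp : p ∈ φ.source) :
    γ.tangentPlane p = Submodule.span ℝ (range fun k => γ.coordVec φ k (φ p)) := by
  have hy := φ.map_source hp
  have hs : MDifferentiableAt (𝓡 n) (𝓡 n) φ.symm (φ p) :=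
    ((contMDiffOn_symm_of_mem_maximalAtlas hφ).contMDiffAt
      (φ.open_target.mem_nhds hy)).mdifferentiableAt (by simp)
  have hf : MDifferentiableAt (𝓡 n) (𝓡 n) φ p :=
    ((contMDiffOn_of_mem_maximalAtlas hφ).contMDiffAt
      (φ.open_source.mem_nhds hp)).mdifferentiableAt (by simp)
  have hγ : MDifferentiableAt (𝓡 n) 𝓘(ℝ, EuclideanSpace ℝ (Fin (n + 1))) γ.toFun
      (φ.symm (φ p)) := γ.contMDiff.contMDiffAt.mdifferentiableAt (by simp)
  have hX : MDifferentiableAt (𝓡 n) 𝓘(ℝ, EuclideanSpace ℝ (Fin (n + 1)))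
      (γ.toFun ∘ φ.symm) (φ p) := hγ.comp _ hs
  refine le_antisymm ?_ (Submodule.span_le.mpr ?_)
  · rintro _ ⟨v, rfl⟩
    have he : γ.toFun =ᶠ[nhds p] (γ.toFun ∘ φ.symm) ∘ φ := by
      filter_upwards [φ.open_source.mem_nhds hp] with q hq
      simp [φ.left_inv hq]
    have h1 : mfderiv (𝓡 n) 𝓘(ℝ, EuclideanSpace ℝ (Fin (n + 1))) γ.toFun p =
        (mfderiv (𝓡 n) 𝓘(ℝ, EuclideanSpace ℝ (Fin (n + 1))) (γ.toFun ∘ φ.symm) (φ p)).comp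
          (mfderiv (𝓡 n) (𝓡 n) φ p) := he.mfderiv_eq.trans (mfderiv_comp p hX hf)
    have h2 : mfderiv (𝓡 n) 𝓘(ℝ, EuclideanSpace ℝ (Fin (n + 1))) γ.toFun p v =
        fderiv ℝ (γ.toFun ∘ φ.symm) (φ p) (mfderiv (𝓡 n) (𝓡 n) φ p v) := by
      rw [h1, mfderiv_eq_fderiv]
      rfl
    have h3 := h2.trans (apply_eq_sum_single (fderiv ℝ (γ.toFun ∘ φ.symm) (φ p)) _)
    refine (congrArg (· ∈ Submodule.span ℝ (range fun k => γ.coordVec φ k (φ p))) h3).mpr ?_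
    exact Submodule.sum_mem _ fun k _ => Submodule.smul_mem _ _
      (Submodule.subset_span (mem_range_self k))
  · rintro _ ⟨k, rfl⟩
    have h1 : mfderiv (𝓡 n) 𝓘(ℝ, EuclideanSpace ℝ (Fin (n + 1))) (γ.toFun ∘ φ.symm) (φ p) =
        (mfderiv (𝓡 n) 𝓘(ℝ, EuclideanSpace ℝ (Fin (n + 1))) γ.toFun (φ.symm (φ p))).comp
          (mfderiv (𝓡 n) (𝓡 n) φ.symm (φ p)) := mfderiv_comp _ hγ hs
    rw [mfderiv_eq_fderiv] at h1
    have h2 : γ.coordVec φ k (φ p) ∈ γ.tangentPlane (φ.symm (φ p)) :=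
      ⟨mfderiv (𝓡 n) (𝓡 n) φ.symm (φ p) (EuclideanSpace.single k 1),
        (congrArg (fun l : EuclideanSpace ℝ (Fin n) →L[ℝ] EuclideanSpace ℝ (Fin (n + 1)) =>
          l (EuclideanSpace.single k 1)) h1).symm⟩
    rwa [φ.left_inv hp] at h2

/-- The component of `e` normal to the hypersurface, in the chart `φ`. -/
noncomputable def normalPart (φ : OpenPartialHomeomorph M (EuclideanSpace ℝ (Fin n)))
    (e : EuclideanSpace ℝ (Fin (n + 1))) (y : EuclideanSpace ℝ (Fin n)) :
    EuclideanSpace ℝ (Fin (n + 1)) :=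
  e - ∑ k, ((γ.metricMatrix φ y)⁻¹.mulVec fun l => inner ℝ (γ.coordVec φ l y) e) k •
    γ.coordVec φ k y

/-- This expresses the normal projection through the inverse Gram matrix of the coordinate vectors,
a formula whose continuity in the point is visible. -/
theorem starProjection_orthogonal_tangentPlane (hφ : φ ∈ IsManifold.maximalAtlas (𝓡 n) ∞ M)
    {p : M} (hp : p ∈ φ.source) (e : EuclideanSpace ℝ (Fin (n + 1))) :
    (γ.tangentPlane p)ᗮ.starProjection e = γ.normalPart φ e (φ p) := by
  have hdet : IsUnit (γ.metricMatrix φ (φ p)).det :=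
    isUnit_iff_ne_zero.mpr (γ.det_metricMatrix_pos hφ (φ.map_source hp)).ne'
  have hspan := γ.tangentPlane_eq_span hφ hp
  refine (Submodule.eq_starProjection_of_mem_of_inner_eq_zero (K := (γ.tangentPlane p)ᗮ)
    (u := e) (v := γ.normalPart φ e (φ p)) ?_ ?_)
  · rw [hspan, Submodule.mem_orthogonal]
    intro w hw
    induction hw using Submodule.span_induction with
    | mem w hw =>
      obtain ⟨l, rfl⟩ := hw
      have h1 := congrFun (Matrix.mulVec_mulVec (fun l => inner ℝ (γ.coordVec φ l (φ p)) e)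
        (γ.metricMatrix φ (φ p)) (γ.metricMatrix φ (φ p))⁻¹) l
      rw [Matrix.mul_nonsing_inv _ hdet, Matrix.one_mulVec] at h1
      rw [normalPart, inner_sub_right, inner_sum, ← h1, sub_eq_zero]
      simp only [real_inner_smul_right, Matrix.mulVec, dotProduct, metricMatrix,
        Matrix.gram_apply]
      exact Finset.sum_congr rfl fun k _ => mul_comm _ _
    | zero => exact inner_zero_left _
    | add x z _ _ hx hz => rw [inner_add_left, hx, hz, add_zero]
    | smul a x _ hx => rw [real_inner_smul_left, hx, mul_zero]
  · intro w hw
    have : e - γ.normalPart φ e (φ p) ∈ γ.tangentPlane p := by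
      rw [normalPart, sub_sub_cancel, hspan]
      exact Submodule.sum_mem _ fun k _ => Submodule.smul_mem _ _
        (Submodule.subset_span (mem_range_self k))
    exact (Submodule.mem_orthogonal _ _).mp hw _ this

/-- The formula for `|B|²` in an arbitrary chart. -/
theorem normSqB_eq [IsManifold (𝓡 n) ∞ M] (hφ : φ ∈ IsManifold.maximalAtlas (𝓡 n) ∞ M) {p : M}
    (hp : p ∈ φ.source) :
    γ.normSqB p = ∑ a : Fin (n + 1),
      (γ.shapeMatrixIn φ (φ p) (γ.normalPart φ (EuclideanSpace.single a 1) (φ p)) *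
        γ.shapeMatrixIn φ (φ p) (γ.normalPart φ (EuclideanSpace.single a 1) (φ p))).trace := by
  refine Finset.sum_congr rfl fun a _ => ?_
  rw [γ.starProjection_orthogonal_tangentPlane hφ hp]
  set ψ := chartAt (EuclideanSpace ℝ (Fin n)) p
  have hψ : ψ ∈ IsManifold.maximalAtlas (𝓡 n) ∞ M := IsManifold.chart_mem_maximalAtlas p
  have hpψ : p ∈ ψ.source := mem_chart_source _ p
  have hτ : (φ ∘ ψ.symm) (ψ p) = φ p := by simp [ψ.left_inv hpψ]
  set N := γ.normalPart φ (EuclideanSpace.single a 1) (φ p) with hN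
  have hNo : ∀ k, inner ℝ (γ.coordVec φ k ((φ ∘ ψ.symm) (ψ p))) N = 0 := by
    intro k
    rw [hτ, hN, ← γ.starProjection_orthogonal_tangentPlane hφ hp]
    refine (Submodule.mem_orthogonal _ _).mp (Submodule.starProjection_apply_mem _ _) _ ?_
    rw [γ.tangentPlane_eq_span hφ hp]
    exact Submodule.subset_span (mem_range_self k)
  have h := γ.trace_shapeMatrixIn_transition hφ hψ (ψ.map_source hpψ)
    (by rwa [ψ.left_inv hpψ]) hNo
  rw [hτ] at h
  exact h

theorem continuousOn_metricMatrix_inv (hφ : φ ∈ IsManifold.maximalAtlas (𝓡 n) ∞ M) :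
    ContinuousOn (fun y => (γ.metricMatrix φ y)⁻¹) φ.target := by
  have h : ContinuousOn (fun y => γ.metricMatrix φ y) φ.target :=
    continuousOn_pi.mpr fun i => continuousOn_pi.mpr fun j =>
      (γ.continuousOn_coordVec hφ i).inner (γ.continuousOn_coordVec hφ j)
  simp only [Matrix.inv_def, Ring.inverse_eq_inv']
  refine ContinuousOn.smul (ContinuousOn.inv₀ ?_ fun y hy =>
    (γ.det_metricMatrix_pos hφ hy).ne') ?_
  · exact (Continuous.matrix_det continuous_id).comp_continuousOn h
  · exact (Continuous.matrix_adjugate continuous_id).comp_continuousOn h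

theorem continuousOn_normalPart (hφ : φ ∈ IsManifold.maximalAtlas (𝓡 n) ∞ M)
    (e : EuclideanSpace ℝ (Fin (n + 1))) : ContinuousOn (γ.normalPart φ e) φ.target := by
  unfold normalPart
  refine continuousOn_const.sub (continuousOn_finsetSum _ fun k _ => ?_)
  refine ContinuousOn.fun_smul ?_ (γ.continuousOn_coordVec hφ k)
  simp only [Matrix.mulVec, dotProduct]
  refine continuousOn_finsetSum _ fun l _ => ContinuousOn.mul ?_ ?_
  · exact continuousOn_pi.mp (continuousOn_pi.mp (γ.continuousOn_metricMatrix_inv hφ) k) l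
  · exact (γ.continuousOn_coordVec hφ l).inner continuousOn_const

/-- The definition of `normSqB` uses a chart that changes with the point. Near a given point,
`normSqB_eq` rewrites it in one fixed chart, where all ingredients are continuous. -/
theorem continuous_normSqB [IsManifold (𝓡 n) ∞ M] : Continuous γ.normSqB := by
  refine continuous_iff_continuousAt.mpr fun p => ?_
  set φ := chartAt (EuclideanSpace ℝ (Fin n)) p
  have hφ : φ ∈ IsManifold.maximalAtlas (𝓡 n) ∞ M := IsManifold.chart_mem_maximalAtlas p
  have hp : p ∈ φ.source := mem_chart_source _ p
  suffices h : ContinuousOn γ.normSqB φ.source from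
    h.continuousAt (φ.open_source.mem_nhds hp)
  have hS : ∀ a : Fin (n + 1), ContinuousOn (fun y => γ.shapeMatrixIn φ y
      (γ.normalPart φ (EuclideanSpace.single a 1) y)) φ.target := fun a => by
    refine ContinuousOn.mul (γ.continuousOn_metricMatrix_inv hφ) ?_
    exact continuousOn_pi.mpr fun i => continuousOn_pi.mpr fun j =>
      (γ.continuousOn_coordHess hφ i j).inner (γ.continuousOn_normalPart hφ _)
  have h1 : ContinuousOn (fun y => ∑ a : Fin (n + 1),
      (γ.shapeMatrixIn φ y (γ.normalPart φ (EuclideanSpace.single a 1) y) *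
        γ.shapeMatrixIn φ y (γ.normalPart φ (EuclideanSpace.single a 1) y)).trace) φ.target :=
    continuousOn_finsetSum _ fun a _ =>
      (Continuous.matrix_trace continuous_id).comp_continuousOn ((hS a).mul (hS a))
  exact (h1.comp φ.continuousOn φ.mapsTo).congr fun q hq => γ.normSqB_eq hφ hq

end Curvature

end ImmersedHypersurface

/-! ### Generalized Lipschitz domains are open with compact closure -/

section DomainTopology

variable {n : ℕ} [NeZero n] {M : Type*} [TopologicalSpace M]
  [ChartedSpace (EuclideanSpace ℝ (Fin n)) M]

/-- Open mapping at a point with surjective differential. At an interior point the range of the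
model with corners is a neighbourhood in coordinates, so derivatives within the half space are
ordinary derivatives and the inverse function theorem applies. -/
theorem IsBoundaryGluingMap.map_nhds_eq {D' : Type*} [TopologicalSpace D']
    [ChartedSpace (EuclideanHalfSpace n) D'] {ρ : D' → M}
    (hρ : IsBoundaryGluingMap (n := n) ρ) {p : D'} (hp : p ∈ (𝓡∂ n).interior D') :
    Filter.map ρ (nhds p) = nhds (ρ p) := by
  set ψ := extChartAt (𝓡∂ n) p with hψ
  set ψ' := extChartAt (𝓡 n) (ρ p) with hψ'
  set w := ψ' ∘ ρ ∘ ψ.symm with hw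
  have hr : range (𝓡∂ n) ∈ nhds (ψ p) := range_mem_nhds_isInteriorPoint hp
  have hcont : ContinuousAt ρ p := hρ.contMDiff.continuous.continuousAt
  have hwd : ContDiffAt ℝ ∞ w (ψ p) :=
    ((contMDiffAt_iff.mp (hρ.contMDiff p)).2).contDiffAt hr
  have hsurj : (fderiv ℝ w (ψ p)).range = ⊤ := by
    let A : EuclideanSpace ℝ (Fin n) →L[ℝ] EuclideanSpace ℝ (Fin n) :=
      mfderiv (𝓡∂ n) (𝓡 n) ρ p
    have hA : HasFDerivWithinAt w A (range (𝓡∂ n)) (ψ p) :=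
      ((hρ.contMDiff p).mdifferentiableAt (by simp)).hasMFDerivAt.2
    rw [(hA.hasFDerivAt hr).fderiv]
    exact LinearMap.range_eq_top.mpr (hρ.bijective_mfderiv p hp).2
  have hmap := (hwd.hasStrictFDerivAt (by simp)).map_nhds_eq_of_surj hsurj
  have hp0 : ψ.symm (ψ p) = p := extChartAt_to_inv p
  have h1 : Filter.map ψ.symm (nhds (ψ p)) = nhds p := by
    have := map_extChartAt_symm_nhdsWithin_range (I := 𝓡∂ n) p
    rwa [nhdsWithin_eq_nhds.mpr hr] at this
  have h2 : Filter.map ψ'.symm (nhds (ψ' (ρ p))) = nhds (ρ p) := by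
    have := map_extChartAt_symm_nhdsWithin_range (I := 𝓡 n) (ρ p)
    rwa [ModelWithCorners.range_eq_univ, nhdsWithin_univ] at this
  have hwp : w (ψ p) = ψ' (ρ p) := by simp only [hw, Function.comp_apply, hp0]
  rw [hwp] at hmap
  have h3 : ψ'.symm ∘ ψ' ∘ ρ =ᶠ[nhds p] ρ := by
    filter_upwards [hcont (extChartAt_source_mem_nhds (I := 𝓡 n) (ρ p))] with q hq
    exact ψ'.left_inv hq
  rw [← h2, ← hmap, Filter.map_map, ← Filter.map_congr h3]
  nth_rewrite 1 [← h1]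
  rw [Filter.map_map]
  rfl

theorem IsGenLipschitzDomain.isOpen {D : Set M} (hD : IsGenLipschitzDomain n D) : IsOpen D := by
  obtain ⟨D', _, _, _, _, _, ρ, hρ, rfl, -⟩ := hD
  refine isOpen_iff_mem_nhds.mpr ?_
  rintro _ ⟨p, hp, rfl⟩
  rw [← hρ.map_nhds_eq hp]
  exact Filter.image_mem_map
    (((𝓡∂ n).isOpen_interior (M := D') (n := ∞) (by simp)).mem_nhds hp)

theorem IsGenLipschitzDomain.isCompact_closure [T2Space M] {D : Set M}
    (hD : IsGenLipschitzDomain n D) : IsCompact (closure D) := by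
  obtain ⟨D', _, _, _, _, _, ρ, hρ, rfl, -⟩ := hD
  exact (isCompact_range hρ.contMDiff.continuous).closure_of_subset (image_subset_range _ _)

end DomainTopology

namespace ImmersedHypersurface

/-! ### Weak and classical gradients -/

section WeakGradient

variable {n : ℕ} {M : Type*} [TopologicalSpace M] [ChartedSpace (EuclideanSpace ℝ (Fin n)) M]
  {φ : OpenPartialHomeomorph M (EuclideanSpace ℝ (Fin n))} {D : Set M} {f : M → ℝ}

theorem contDiffOn_indicator_comp_symm (hφ : φ ∈ IsManifold.maximalAtlas (𝓡 n) ∞ M)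
    (hf : f ∈ F₀ n D) :
    ContDiffOn ℝ ∞ (D.indicator f ∘ φ.symm) (φ.target ∩ φ.symm ⁻¹' D) := by
  have h1 : ContMDiffOn (𝓡 n) 𝓘(ℝ, ℝ) ∞ (f ∘ φ.symm) (φ.target ∩ φ.symm ⁻¹' D) :=
    hf.1.comp ((contMDiffOn_symm_of_mem_maximalAtlas hφ).mono inter_subset_left)
      inter_subset_right
  exact h1.contDiffOn.congr fun y hy =>
    indicator_of_mem (show φ.symm y ∈ D from hy.2) f

variable [T2Space M] [MeasurableSpace M] [BorelSpace M] (γ : ImmersedHypersurface n M)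

/-- The weak gradient of a function which is smooth on `D` is its gradient. -/
theorem ae_fderiv_eq_inner (hφ : φ ∈ IsManifold.maximalAtlas (𝓡 n) ∞ M) (hD : IsOpen D)
    (hf : f ∈ F₀ n D) {u : γ.L2Pair D} (hu : u ∈ γ.W12 D)
    (huf : u.fst =ᵐ[γ.area.restrict D] f) (i : Fin n) :
    ∀ᵐ y, y ∈ φ.target ∩ φ.symm ⁻¹' D →
      fderiv ℝ (D.indicator f ∘ φ.symm) y (EuclideanSpace.single i 1) =
        inner ℝ (u.snd (φ.symm y)) (γ.coordVec φ i y) := by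
  set F := D.indicator f ∘ φ.symm with hF
  set U := φ.target ∩ φ.symm ⁻¹' D with hU
  have hUo : IsOpen U := φ.symm.isOpen_inter_preimage hD
  have hFc : ContDiffOn ℝ ∞ F U := contDiffOn_indicator_comp_symm hφ hf
  have hFd : ContinuousOn (fun y => fderiv ℝ F y (EuclideanSpace.single i 1)) U :=
    (hFc.continuousOn_fderiv_of_isOpen hUo (by simp)).clm_apply continuousOn_const
  have hint : ∀ K ⊆ U, IsCompact K →
      IntegrableOn (fun y => inner ℝ (u.snd (φ.symm y)) (γ.coordVec φ i y)) K := by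
    intro K hKU hK
    have hv := γ.integrableOn_comp_symm hφ hK hKU u.snd
    have hX : ContinuousOn (γ.coordVec φ i) K :=
      (γ.continuousOn_coordVec hφ i).mono fun y hy => (hKU hy).1
    obtain ⟨C, hC⟩ := hK.exists_bound_of_continuousOn hX
    refine Integrable.mono' (hv.norm.mul_const C)
      (hv.aestronglyMeasurable.inner (hX.aestronglyMeasurable hK.measurableSet)) ?_
    filter_upwards [ae_restrict_mem hK.measurableSet] with y hy
    exact (norm_inner_le_norm _ _).trans (mul_le_mul_of_nonneg_left (hC y hy) (norm_nonneg _))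
  -- Fundamental lemma of the calculus of variations: the difference of the classical and the weak
  -- derivative is locally integrable and annihilates every test function, because both satisfy the
  -- same integration by parts formula.
  have hloc : LocallyIntegrableOn (fun y => fderiv ℝ F y (EuclideanSpace.single i 1) -
      inner ℝ (u.snd (φ.symm y)) (γ.coordVec φ i y)) U := by
    rw [locallyIntegrableOn_iff hUo.isLocallyClosed]
    exact fun K hKU hK => ((hFd.mono hKU).integrableOn_compact hK).sub (hint K hKU hK)
  have hzero := hUo.ae_eq_zero_of_integral_contDiff_smul_eq_zero hloc fun η hη hc hs => ?_
  · filter_upwards [hzero] with y hy hyU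
    exact sub_eq_zero.mp (hy hyU)
  have hsupp : ∀ (h : EuclideanSpace ℝ (Fin n) → ℝ), ContinuousOn h U →
      Integrable fun y => h y * η y := fun h hh => by
    refine (integrableOn_iff_integrable_of_support_subset (s := tsupport η) ?_).mp ?_
    · exact fun y hy => subset_tsupport _ (right_ne_zero_of_mul hy)
    · exact ((hh.mono hs).mul hη.continuous.continuousOn).integrableOn_compact hc
  have hηd : Continuous fun y => fderiv ℝ η y (EuclideanSpace.single i 1) :=
    (hη.continuous_fderiv (by simp)).clm_apply continuous_const
  have hsupp' : Integrable fun y => F y * fderiv ℝ η y (EuclideanSpace.single i 1) := by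
    refine (integrableOn_iff_integrable_of_support_subset (s := tsupport η) ?_).mp ?_
    · intro y hy
      by_contra hn
      exact hy (by simp [fderiv_of_notMem_tsupport ℝ hn])
    · exact ((hFc.continuousOn.mono hs).mul hηd.continuousOn).integrableOn_compact hc
  have hparts : ∫ y, F y * fderiv ℝ η y (EuclideanSpace.single i 1) =
      - ∫ y, fderiv ℝ F y (EuclideanSpace.single i 1) * η y :=
    integral_mul_fderiv_eq_neg_fderiv_mul_of_integrable (hsupp _ hFd) hsupp'
      (hsupp F hFc.continuousOn)
      (fun y hy => (hFc.contDiffAt (hUo.mem_nhds (hs hy))).differentiableAt (by simp))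
      (fun y _ => hη.differentiable (by simp) y)
  have hweak := hu.2 φ hφ i η hη hc hs
  have hae := γ.ae_comp_symm hφ hc hs huf
  rw [ae_restrict_iff' hc.measurableSet] at hae
  have heq : ∫ y, u.fst (φ.symm y) * fderiv ℝ η y (EuclideanSpace.single i 1) =
      ∫ y, F y * fderiv ℝ η y (EuclideanSpace.single i 1) := by
    refine integral_congr_ae ?_
    filter_upwards [hae] with y hy
    by_cases hyt : y ∈ tsupport η
    · rw [hy hyt, hF, Function.comp_apply,
        indicator_of_mem (show φ.symm y ∈ D from (hs hyt).2)]
    · simp [fderiv_of_notMem_tsupport ℝ hyt]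
  have hi : Integrable fun y => inner ℝ (u.snd (φ.symm y)) (γ.coordVec φ i y) * η y :=
    γ.integrable_inner_test hφ hη hc hs u.snd i
  simp only [smul_eq_mul, mul_comm (η _), sub_mul]
  rw [integral_sub (hsupp _ hFd) hi]
  linarith [hweak, heq, hparts]

/-- Compares the Euclidean gradient in a chart with the gradient on the hypersurface; the factor `∑
‖∂ᵢX‖` is bounded on compact subsets of the chart. -/
theorem ae_norm_fderiv_le (hφ : φ ∈ IsManifold.maximalAtlas (𝓡 n) ∞ M) (hD : IsOpen D)
    (hf : f ∈ F₀ n D) {u : γ.L2Pair D} (hu : u ∈ γ.W12 D)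
    (huf : u.fst =ᵐ[γ.area.restrict D] f) :
    ∀ᵐ y, y ∈ φ.target ∩ φ.symm ⁻¹' D →
      ‖fderiv ℝ (D.indicator f ∘ φ.symm) y‖ ≤
        ‖u.snd (φ.symm y)‖ * ∑ i, ‖γ.coordVec φ i y‖ := by
  have h := ae_all_iff.mpr fun i => γ.ae_fderiv_eq_inner hφ hD hf hu huf i
  filter_upwards [h] with y hy hyU
  refine ContinuousLinearMap.opNorm_le_bound _ (by positivity) fun w => ?_
  rw [apply_eq_sum_single]
  calc ‖∑ k, w k • fderiv ℝ (D.indicator f ∘ φ.symm) y (EuclideanSpace.single k 1)‖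
      ≤ ∑ k, ‖w‖ * (‖u.snd (φ.symm y)‖ * ‖γ.coordVec φ k y‖) := by
        refine norm_sum_le_of_le _ fun k _ => ?_
        rw [norm_smul, hy k hyU]
        exact mul_le_mul (PiLp.norm_apply_le w k) (norm_inner_le_norm _ _) (norm_nonneg _)
          (norm_nonneg _)
    _ = _ := by rw [← Finset.mul_sum, ← Finset.mul_sum, mul_comm]

end WeakGradient

end ImmersedHypersurface

/-! ### Partition into small cells, and the variance identity -/

/-- A bounded convex set of `ℝⁿ` is a finite disjoint union of small convex sets. -/
theorem exists_convex_partition {n : ℕ} {K : Set (EuclideanSpace ℝ (Fin n))} (hK : Convex ℝ K)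
    (hKm : MeasurableSet K) (hKb : Bornology.IsBounded K) {d : ℝ} (hd : 0 < d) :
    ∃ (ι : Type) (_ : Fintype ι) (Q : ι → Set (EuclideanSpace ℝ (Fin n))),
      (∀ k, Convex ℝ (Q k) ∧ MeasurableSet (Q k) ∧ Q k ⊆ K ∧
        ∀ x ∈ Q k, ∀ y ∈ Q k, ‖y - x‖ ≤ d) ∧
      Pairwise (fun k l => Disjoint (Q k) (Q l)) ∧ K ⊆ ⋃ k, Q k := by
  obtain ⟨R, hR⟩ := hKb.exists_norm_le
  -- Cells are cut out by half-open cubes of side `δ`, which are convex, disjoint and of diameter at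
  -- most `n * δ ≤ d`. The `+ 1` keeps the denominator positive when `n = 0`.
  set δ : ℝ := d / (n + 1)
  have hδ : 0 < δ := by positivity
  have hδd : n * δ ≤ d := by
    have : (n + 1) * δ = d := by simp only [δ]; field_simp
    nlinarith
  refine ⟨Fin n → Finset.Icc ⌊-R / δ⌋ ⌊R / δ⌋, inferInstance,
    fun k => K ∩ ⋂ i, {y | y i ∈ Ico ((k i : ℤ) * δ) (((k i : ℤ) + 1) * δ)}, ?_, ?_, ?_⟩
  · intro k
    have hc : ∀ i : Fin n, Continuous fun y : EuclideanSpace ℝ (Fin n) => y i := fun i =>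
      (EuclideanSpace.proj i : EuclideanSpace ℝ (Fin n) →L[ℝ] ℝ).continuous
    refine ⟨hK.inter (convex_iInter fun i => ?_), hKm.inter (MeasurableSet.iInter fun i =>
      (hc i).measurable measurableSet_Ico), inter_subset_left, ?_⟩
    · exact (convex_Ico _ _).linear_preimage
        (EuclideanSpace.proj i : EuclideanSpace ℝ (Fin n) →L[ℝ] ℝ).toLinearMap
    · intro x hx y hy
      have hxy : ∀ i, |(y - x) i| ≤ δ := fun i => by
        have h1 := mem_iInter.mp hx.2 i
        have h2 := mem_iInter.mp hy.2 i
        simp only [mem_ofPred_eq, mem_Ico] at h1 h2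
        rw [PiLp.sub_apply, abs_le]
        constructor <;> nlinarith
      calc ‖y - x‖ = ‖∑ i, (y - x) i • EuclideanSpace.single i (1 : ℝ)‖ := by
            conv_lhs => rw [← (EuclideanSpace.basisFun (Fin n) ℝ).sum_repr (y - x)]
            simp
        _ ≤ ∑ _i : Fin n, δ := norm_sum_le_of_le _ fun i _ => by
            rw [norm_smul]; simpa using hxy i
        _ = n * δ := by simp
        _ ≤ d := hδd
  · intro k l hkl
    rw [Set.disjoint_left]
    rintro y ⟨-, h1⟩ ⟨-, h2⟩
    refine hkl (funext fun i => Subtype.ext ?_)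
    have e : ∀ m : ℤ, y i ∈ Ico ((m : ℝ) * δ) ((m + 1) * δ) → ⌊y i / δ⌋ = m := fun m hm => by
      rw [Int.floor_eq_iff, le_div_iff₀ hδ, div_lt_iff₀ hδ]
      exact hm
    rw [← e _ (mem_iInter.mp h1 i), ← e _ (mem_iInter.mp h2 i)]
  · intro y hy
    have hyR : ∀ i, |y i| ≤ R := fun i => (PiLp.norm_apply_le y i).trans (hR y hy)
    refine mem_iUnion.mpr ⟨fun i => ⟨⌊y i / δ⌋, Finset.mem_Icc.mpr ⟨?_, ?_⟩⟩, hy,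
      mem_iInter.mpr fun i => ?_⟩
    · exact Int.floor_mono (div_le_div_of_nonneg_right (abs_le.mp (hyR i)).1 hδ.le)
    · exact Int.floor_mono (div_le_div_of_nonneg_right (abs_le.mp (hyR i)).2 hδ.le)
    · change y i ∈ Ico _ _
      rw [mem_Ico, ← le_div_iff₀ hδ, ← div_lt_iff₀ hδ]
      exact ⟨Int.floor_le _, Int.lt_floor_add_one _⟩

theorem integral_quadratic {α : Type*} [MeasurableSpace α] {ν : Measure α} [IsFiniteMeasure ν]
    {F : α → ℝ} (hF : Integrable F ν) (hF2 : Integrable (fun p => F p ^ 2) ν) (a b c : ℝ) :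
    Integrable (fun p => a * F p ^ 2 + b * F p + c) ν ∧
      ∫ p, (a * F p ^ 2 + b * F p + c) ∂ν =
        a * ∫ p, F p ^ 2 ∂ν + b * ∫ p, F p ∂ν + c * ν.real univ := by
  have h1 : Integrable (fun p => a * F p ^ 2 + b * F p) ν :=
    (hF2.const_mul a).add (hF.const_mul b)
  refine ⟨h1.add (integrable_const c), ?_⟩
  rw [integral_add h1 (integrable_const c), integral_add (hF2.const_mul a) (hF.const_mul b),
    integral_const_mul, integral_const_mul, integral_const, smul_eq_mul, mul_comm c]

/-- The variance as a double integral. -/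
theorem lintegral_lintegral_enorm_sub_sq {α : Type*} [MeasurableSpace α] {ν : Measure α}
    [IsFiniteMeasure ν] {F : α → ℝ} (hF : Integrable F ν) (hF2 : Integrable (fun p => F p ^ 2) ν) :
    ∫⁻ p, ∫⁻ q, ‖F q - F p‖ₑ ^ 2 ∂ν ∂ν =
      ENNReal.ofReal (2 * ν.real univ * ∫ p, F p ^ 2 ∂ν - 2 * (∫ p, F p ∂ν) ^ 2) := by
  set a := ν.real univ
  set S := ∫ p, F p ^ 2 ∂ν
  set I := ∫ p, F p ∂ν
  have hsq : ∀ p q, (F q - F p) ^ 2 = 1 * F q ^ 2 + (-2 * F p) * F q + F p ^ 2 := fun p q => by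
    ring
  have hint : ∀ p, ∫ q, (F q - F p) ^ 2 ∂ν = a * F p ^ 2 + (-2 * I) * F p + S := fun p => by
    simp_rw [hsq p]
    rw [(integral_quadratic hF hF2 _ _ _).2]
    ring
  have hinner : ∀ p, ∫⁻ q, ‖F q - F p‖ₑ ^ 2 ∂ν =
      ENNReal.ofReal (a * F p ^ 2 + (-2 * I) * F p + S) := fun p => by
    have hi : Integrable (fun q => (F q - F p) ^ 2) ν := by
      simp_rw [hsq p]
      exact (integral_quadratic hF hF2 _ _ _).1
    rw [← hint p, ofReal_integral_eq_lintegral_ofReal hi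
      (Filter.Eventually.of_forall fun q => sq_nonneg _)]
    refine lintegral_congr fun q => ?_
    rw [← ofReal_norm, ← ENNReal.ofReal_pow (norm_nonneg _), Real.norm_eq_abs, sq_abs]
  simp_rw [hinner]
  rw [← ofReal_integral_eq_lintegral_ofReal (integral_quadratic hF hF2 _ _ _).1
      (Filter.Eventually.of_forall fun p =>
        (integral_nonneg fun q => sq_nonneg _).trans_eq (hint p)),
    (integral_quadratic hF hF2 _ _ _).2]
  congr 1
  simp only [S, I, a]
  ring

namespace ImmersedHypersurface

/-! ### Poincaré inequality on a cell of the hypersurface -/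

section CellEstimate

variable {n : ℕ} {M : Type*} [TopologicalSpace M] [ChartedSpace (EuclideanSpace ℝ (Fin n)) M]
  [T2Space M] [MeasurableSpace M] [BorelSpace M] (γ : ImmersedHypersurface n M)
  {φ : OpenPartialHomeomorph M (EuclideanSpace ℝ (Fin n))} {D : Set M}

/-- Vanishing on the frontier is what makes the extension by zero continuous across `∂D`. -/
theorem continuous_indicator_of_mem {M : Type*} [TopologicalSpace M]
    [ChartedSpace (EuclideanSpace ℝ (Fin n)) M] {D : Set M} {f : M → ℝ} (hf : f ∈ F₀ n D) : Continuous (D.indicator f) :=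
  continuous_indicator hf.2.2 hf.2.1

theorem target_inter_preimage_image {M : Type*} [TopologicalSpace M]
    {φ : OpenPartialHomeomorph M (EuclideanSpace ℝ (Fin n))} {Q : Set (EuclideanSpace ℝ (Fin n))} (hQ : Q ⊆ φ.target) :
    φ.target ∩ φ.symm ⁻¹' (φ.symm '' Q) = Q := by
  ext y
  constructor
  · rintro ⟨hy, z, hz, hzy⟩
    exact φ.symm.injOn (hQ hz) hy hzy ▸ hz
  · exact fun hy => ⟨hQ hy, y, hy, rfl⟩

theorem measurableSet_image_symm {M : Type*} [TopologicalSpace M] [MeasurableSpace M]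
    [BorelSpace M] {φ : OpenPartialHomeomorph M (EuclideanSpace ℝ (Fin n))} {Q : Set (EuclideanSpace ℝ (Fin n))} (hQ : Q ⊆ φ.target)
    (hQm : MeasurableSet Q) : MeasurableSet (φ.symm '' Q) := by
  have h : φ.symm '' Q = φ.source ∩ φ ⁻¹' Q := φ.symm.image_eq_target_inter_inv_preimage hQ
  rw [h]
  have h : Measurable (φ.source.domRestrict φ) :=
    (continuousOn_iff_continuous_domRestrict.mp φ.continuousOn).measurable
  have := φ.open_source.measurableSet.subtype_image (h hQm)
  convert this using 1
  ext y
  exact ⟨fun hy => ⟨⟨y, hy.1⟩, hy.2, rfl⟩, fun ⟨z, hz, hzy⟩ => hzy ▸ ⟨z.2, hz⟩⟩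

/-- Poincaré inequality on the image of a small convex set of a chart. -/
theorem exists_lintegral_cell_le (hφ : φ ∈ IsManifold.maximalAtlas (𝓡 n) ∞ M) (hD : IsOpen D)
    {K : Set (EuclideanSpace ℝ (Fin n))} (hK : IsCompact K) (hKφ : K ⊆ φ.target) :
    ∃ κ : ℝ, 0 ≤ κ ∧ ∀ Q ⊆ K, Convex ℝ Q → MeasurableSet Q → ∀ d : ℝ, 0 ≤ d →
      (∀ x ∈ Q, ∀ y ∈ Q, ‖y - x‖ ≤ d) → ∀ f ∈ F₀ n D, ∀ u ∈ γ.W12 D,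
      u.fst =ᵐ[γ.area.restrict D] f →
      ∫⁻ p in φ.symm '' Q, ‖D.indicator f p‖ₑ ^ 2 ∂γ.area ≤
        ENNReal.ofReal ((γ.area.real (φ.symm '' Q))⁻¹ *
          (∫ p in φ.symm '' Q, D.indicator f p ∂γ.area) ^ 2) +
        ENNReal.ofReal (κ * d ^ 2) *
          ∫⁻ p in φ.symm '' Q, ‖u.snd p‖ₑ ^ 2 ∂(γ.area.restrict D) := by
  rcases K.eq_empty_or_nonempty with rfl | hne
  · refine ⟨0, le_rfl, fun Q hQ => ?_⟩
    obtain rfl := subset_empty_iff.mp hQ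
    simp
  set ρ : EuclideanSpace ℝ (Fin n) → ℝ := fun y => Real.sqrt (γ.metricMatrix φ y).det with hρ
  have hρc : ContinuousOn ρ K := (γ.continuousOn_sqrt_det hφ).mono hKφ
  obtain ⟨G, hG⟩ := hK.exists_bound_of_continuousOn hρc
  obtain ⟨z, hz, hmin⟩ := hK.exists_isMinOn hne hρc
  set m := ρ z
  have hm : 0 < m := Real.sqrt_pos.mpr (γ.det_metricMatrix_pos hφ (hKφ hz))
  have hG0 : 0 ≤ G := (norm_nonneg _).trans (hG z hz)
  have hVc : ContinuousOn (fun y => ∑ i, ‖γ.coordVec φ i y‖) K :=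
    continuousOn_finsetSum _ fun i _ => ((γ.continuousOn_coordVec hφ i).mono hKφ).norm
  obtain ⟨V, hV⟩ := hK.exists_bound_of_continuousOn hVc
  have hV0 : 0 ≤ V := (norm_nonneg _).trans (hV z hz)
  -- `G ^ 2` bounds the two area densities in the double integral, `2 ^ n` is the Poincaré constant,
  -- `V ^ 2` compares the gradients, and each `m⁻¹` converts one Lebesgue integral back to area: the
  -- volume of `Q` and the energy.
  set κ : ℝ := G ^ 2 * 2 ^ n * V ^ 2 * m⁻¹ ^ 2 with hκ
  have hκ0 : 0 ≤ κ := by positivity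
  refine ⟨κ, hκ0, ?_⟩
  intro Q hQK hQc hQm d hd0 hd f hf u hu huf
  have hQφ : Q ⊆ φ.target := hQK.trans hKφ
  set A := φ.symm '' Q with hA
  have hAm : MeasurableSet A := measurableSet_image_symm hQφ hQm
  have hAs : A ⊆ φ.source := by
    rintro _ ⟨y, hy, rfl⟩
    exact φ.map_target (hQφ hy)
  have hAQ : φ.target ∩ φ.symm ⁻¹' A = Q := target_inter_preimage_image hQφ
  have hAfin : γ.area A < ⊤ :=
    (measure_mono (image_mono hQK)).trans_lt (γ.area_image_lt_top hφ hK hKφ)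
  have : IsFiniteMeasure (γ.area.restrict A) := ⟨by simpa using hAfin⟩
  set F := D.indicator f with hF
  have hFc : Continuous F := continuous_indicator_of_mem hf
  set O := φ.target ∩ φ.symm ⁻¹' D with hO
  have hOo : IsOpen O := φ.symm.isOpen_inter_preimage hD
  set H := F ∘ φ.symm with hH
  -- bound of the double integral
  have hdouble : ∫⁻ p in A, ∫⁻ q in A, ‖F q - F p‖ₑ ^ 2 ∂γ.area ∂γ.area ≤
      ENNReal.ofReal (G ^ 2) * ∫⁻ x in Q, ∫⁻ y in Q, ‖H y - H x‖ₑ ^ 2 := by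
    have hinner : ∀ p, ∫⁻ q in A, ‖F q - F p‖ₑ ^ 2 ∂γ.area =
        ∫⁻ y in Q, ENNReal.ofReal (ρ y) * ‖H y - F p‖ₑ ^ 2 := fun p => by
      rw [γ.lintegral_area hφ hAm hAs
        (G := fun q => ‖F q - F p‖ₑ ^ 2) (by fun_prop), hAQ]
      rfl
    have hmeas : Measurable fun p => ∫⁻ q in A, ‖F q - F p‖ₑ ^ 2 ∂γ.area := by
      refine Measurable.lintegral_prod_right' (f := fun r : M × M => ‖F r.2 - F r.1‖ₑ ^ 2) ?_
      exact (((hFc.measurable.comp measurable_snd).sub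
        (hFc.measurable.comp measurable_fst)).enorm).pow_const 2
    have hle : ∀ y ∈ Q, ENNReal.ofReal (ρ y) ≤ ENNReal.ofReal G := fun y hy =>
      ENNReal.ofReal_le_ofReal ((le_abs_self _).trans (hG y (hQK hy)))
    rw [γ.lintegral_area hφ hAm hAs hmeas, hAQ]
    simp_rw [hinner]
    calc ∫⁻ x in Q, ENNReal.ofReal (ρ x) *
          ∫⁻ y in Q, ENNReal.ofReal (ρ y) * ‖H y - F (φ.symm x)‖ₑ ^ 2
        ≤ ∫⁻ x in Q, ENNReal.ofReal G * ∫⁻ y in Q, ENNReal.ofReal G * ‖H y - H x‖ₑ ^ 2 := by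
          refine setLIntegral_mono' hQm fun x hx => ?_
          refine mul_le_mul' (hle x hx) (setLIntegral_mono' hQm fun y hy => ?_)
          exact mul_le_mul' (hle y hy) le_rfl
      _ = _ := by
          simp_rw [lintegral_const_mul' _ _ ENNReal.ofReal_ne_top]
          rw [sq, ENNReal.ofReal_mul hG0, mul_assoc]
  -- In coordinates the extended function is smooth on `O` and zero on the rest of `Q`, so `Q` may
  -- cross the boundary of `D`.
  have hpoinc := lintegral_lintegral_enorm_sub_sq_le volume hQc hQm hd hOo (F := H)
    (hFc.comp_continuousOn (φ.continuousOn_symm.mono hQφ))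
    (fun x hx => ((contDiffOn_indicator_comp_symm hφ hf).contDiffAt
      (hOo.mem_nhds hx.2)).differentiableAt (by simp))
    (fun x hx hxO =>
      indicator_of_notMem (show φ.symm x ∉ D from fun h => hxO ⟨hQφ hx, h⟩) f)
  rw [finrank_euclideanSpace_fin] at hpoinc
  have hmle : ∀ y ∈ Q, ENNReal.ofReal m ≤ ENNReal.ofReal (ρ y) := fun y hy =>
    ENNReal.ofReal_le_ofReal (hmin (hQK hy))
  have hm1 : ENNReal.ofReal m⁻¹ * ENNReal.ofReal m = 1 := by
    rw [← ENNReal.ofReal_mul (by positivity), inv_mul_cancel₀ hm.ne', ENNReal.ofReal_one]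
  set T := ∫⁻ p in A, ‖u.snd p‖ₑ ^ 2 ∂(γ.area.restrict D) with hT
  have hgrad : ∫⁻ x in Q ∩ O, ‖fderiv ℝ H x‖ₑ ^ 2 ≤ ENNReal.ofReal (V ^ 2 * m⁻¹) * T := by
    have hAD : φ.target ∩ φ.symm ⁻¹' (A ∩ D) = Q ∩ O := by
      rw [← hAQ, hO]
      ext y
      simp only [mem_inter_iff, mem_preimage]
      tauto
    have hvm : Measurable fun p => ‖u.snd p‖ₑ ^ 2 :=
      ((Lp.stronglyMeasurable u.snd).measurable.enorm).pow_const 2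
    have hTe : T = ∫⁻ y in Q ∩ O, ENNReal.ofReal (ρ y) * ‖u.snd (φ.symm y)‖ₑ ^ 2 := by
      rw [hT, Measure.restrict_restrict hAm, γ.lintegral_area hφ (hAm.inter hD.measurableSet)
        (inter_subset_left.trans hAs) hvm, hAD]
    rw [hTe, ← lintegral_const_mul' _ _ ENNReal.ofReal_ne_top]
    refine lintegral_mono_ae ?_
    filter_upwards [ae_restrict_of_ae (γ.ae_norm_fderiv_le hφ hD hf hu huf),
      ae_restrict_mem (hQm.inter hOo.measurableSet)] with y hy hyQ
    have h1 : ‖fderiv ℝ H y‖ ≤ V * ‖u.snd (φ.symm y)‖ := by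
      refine (hy hyQ.2).trans ?_
      rw [mul_comm]
      exact mul_le_mul_of_nonneg_right ((le_abs_self _).trans (hV y (hQK hyQ.1))) (norm_nonneg _)
    have h2 : ‖fderiv ℝ H y‖ₑ ≤ ENNReal.ofReal V * ‖u.snd (φ.symm y)‖ₑ := by
      rw [← ofReal_norm, ← ofReal_norm, ← ENNReal.ofReal_mul hV0]
      exact ENNReal.ofReal_le_ofReal h1
    calc ‖fderiv ℝ H y‖ₑ ^ 2 ≤ (ENNReal.ofReal V * ‖u.snd (φ.symm y)‖ₑ) ^ 2 := by gcongr
      _ = ENNReal.ofReal (V ^ 2) * (ENNReal.ofReal m⁻¹ * ENNReal.ofReal m) *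
            ‖u.snd (φ.symm y)‖ₑ ^ 2 := by
          rw [hm1, mul_one, mul_pow, ENNReal.ofReal_pow hV0]
      _ ≤ ENNReal.ofReal (V ^ 2) * (ENNReal.ofReal m⁻¹ * ENNReal.ofReal (ρ y)) *
            ‖u.snd (φ.symm y)‖ₑ ^ 2 := by
          gcongr
          exact hmin (hQK hyQ.1)
      _ = _ := by
          rw [ENNReal.ofReal_mul (by positivity)]
          ring
  have hvol : volume Q ≤ ENNReal.ofReal m⁻¹ * γ.area A := by
    rw [γ.area_apply hφ hAm hAs, hAQ, ← lintegral_const_mul' _ _ ENNReal.ofReal_ne_top,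
      ← setLIntegral_one]
    refine setLIntegral_mono' hQm fun y hy => ?_
    rw [← hm1]
    exact mul_le_mul' le_rfl (hmle y hy)
  have hTfin : T < ⊤ := by
    have h := (Lp.memLp u.snd).eLpNorm_lt_top
    have h1 : ∫⁻ p, ‖u.snd p‖ₑ ^ 2 ∂(γ.area.restrict D) < ⊤ := by
      have := lintegral_rpow_enorm_lt_top_of_eLpNorm_lt_top (by norm_num) (by norm_num) h
      simpa using this
    exact (setLIntegral_le_lintegral _ _).trans_lt h1
  have htotal : ∫⁻ p in A, ∫⁻ q in A, ‖F q - F p‖ₑ ^ 2 ∂γ.area ∂γ.area ≤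
      ENNReal.ofReal (κ * d ^ 2) * γ.area A * T := by
    calc _ ≤ ENNReal.ofReal (G ^ 2) * (ENNReal.ofReal (2 ^ n * d ^ 2) *
          (ENNReal.ofReal m⁻¹ * γ.area A) * (ENNReal.ofReal (V ^ 2 * m⁻¹) * T)) := by
          refine hdouble.trans (mul_le_mul' le_rfl (hpoinc.trans ?_))
          exact mul_le_mul' (mul_le_mul' le_rfl hvol) hgrad
      _ = ENNReal.ofReal (G ^ 2) * ENNReal.ofReal (2 ^ n * d ^ 2) * ENNReal.ofReal m⁻¹ *
          ENNReal.ofReal (V ^ 2 * m⁻¹) * γ.area A * T := by ring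
      _ = _ := by
          rw [← ENNReal.ofReal_mul (by positivity), ← ENNReal.ofReal_mul (by positivity),
            ← ENNReal.ofReal_mul (by positivity)]
          congr 3
          rw [hκ]
          ring
  -- integrability of the bounded function
  obtain ⟨C, hC⟩ : ∃ C, ∀ p ∈ A, ‖F p‖ ≤ C := by
    have hc : IsCompact (φ.symm '' K) := hK.image_of_continuousOn (φ.continuousOn_symm.mono hKφ)
    obtain ⟨C, hC⟩ := hc.exists_bound_of_continuousOn hFc.continuousOn
    exact ⟨C, fun p hp => hC p (image_mono hQK hp)⟩
  have hFi : Integrable F (γ.area.restrict A) :=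
    Integrable.of_bound hFc.measurable.aestronglyMeasurable C
      ((ae_restrict_mem hAm).mono hC)
  have hFi2 : Integrable (fun p => F p ^ 2) (γ.area.restrict A) :=
    Integrable.of_bound (hFc.measurable.pow_const 2).aestronglyMeasurable (C ^ 2)
      ((ae_restrict_mem hAm).mono fun p hp => by
        rw [norm_pow]; exact pow_le_pow_left₀ (norm_nonneg _) (hC p hp) 2)
  have hS : ∫⁻ p in A, ‖F p‖ₑ ^ 2 ∂γ.area = ENNReal.ofReal (∫ p in A, F p ^ 2 ∂γ.area) := by
    rw [ofReal_integral_eq_lintegral_ofReal hFi2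
      (Filter.Eventually.of_forall fun p => sq_nonneg _)]
    refine lintegral_congr fun p => ?_
    rw [← ofReal_norm, ← ENNReal.ofReal_pow (norm_nonneg _), Real.norm_eq_abs, sq_abs]
  -- The variance identity turns the double integral into `2 a S - 2 I²`, so the bound reads `2 a S
  -- - 2 I² ≤ κ d² a T`; it remains to divide by `a`.
  rw [lintegral_lintegral_enorm_sub_sq hFi hFi2] at htotal
  set S := ∫ p in A, F p ^ 2 ∂γ.area
  set I := ∫ p in A, F p ∂γ.area
  set a := γ.area.real A with ha
  have ha' : (γ.area.restrict A).real univ = a := by simp [ha, Measure.real]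
  rw [ha'] at htotal
  have hT' : T = ENNReal.ofReal T.toReal := (ENNReal.ofReal_toReal hTfin.ne).symm
  have haA : γ.area A = ENNReal.ofReal a := (ENNReal.ofReal_toReal hAfin.ne).symm
  have ha0 : 0 ≤ a := measureReal_nonneg
  rw [hT', haA, ← ENNReal.ofReal_mul (by positivity), ← ENNReal.ofReal_mul (by positivity),
    ENNReal.ofReal_le_ofReal_iff (by positivity)] at htotal
  rw [hS, hT', ← ENNReal.ofReal_mul (by positivity), ← ENNReal.ofReal_add (by positivity)
    (by positivity)]
  refine ENNReal.ofReal_le_ofReal ?_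
  have hkt : 0 ≤ κ * d ^ 2 * T.toReal := by positivity
  -- A cell of area zero has `S = 0`, and the mean term vanishes since `0⁻¹ = 0`.
  rcases ha0.eq_or_lt with h0 | h0
  · have : γ.area A = 0 := by rw [haA, ← h0, ENNReal.ofReal_zero]
    have hS0 : S = 0 := by
      simp only [S]
      rw [Measure.restrict_eq_zero.mpr this, integral_zero_measure]
    rw [hS0, ← h0]
    simpa using hkt
  · have h2 : a * S ≤ I ^ 2 + a * (κ * d ^ 2 * T.toReal) := by nlinarith
    calc S = a⁻¹ * (a * S) := by field_simp
      _ ≤ a⁻¹ * (I ^ 2 + a * (κ * d ^ 2 * T.toReal)) := by gcongr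
      _ = _ := by field_simp

end CellEstimate

end ImmersedHypersurface

theorem lintegral_enorm_sq_eq {α F : Type*} [MeasurableSpace α] {μ : Measure α}
    [NormedAddCommGroup F] (w : Lp F 2 μ) :
    ∫⁻ p, ‖w p‖ₑ ^ 2 ∂μ = ENNReal.ofReal (‖w‖ ^ 2) := by
  have h := eLpNorm_nnreal_pow_eq_lintegral (μ := μ) (f := w) (p := 2) two_ne_zero
  have h1 : ‖w‖ₑ = eLpNorm w 2 μ := Lp.enorm_def w
  simp only [NNReal.coe_ofNat, ENNReal.rpow_ofNat, ENNReal.coe_ofNat] at h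
  rw [← h, ← h1, ENNReal.ofReal_pow (norm_nonneg _), ofReal_norm]

namespace ImmersedHypersurface

/-! ### Quantitative Rellich inequality -/

section Functionals

variable {n : ℕ} {M : Type*} [TopologicalSpace M] [ChartedSpace (EuclideanSpace ℝ (Fin n)) M]
  [T2Space M] [MeasurableSpace M] [BorelSpace M] (γ : ImmersedHypersurface n M) {D : Set M}

/-- On a neighbourhood of each point, the `L²` norm is controlled by finitely many functionals and a
small multiple of the norm of the gradient. -/
theorem exists_nhds_functionals [IsManifold (𝓡 n) ∞ M] (hD : IsOpen D) (p : M) :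
    ∃ S ∈ nhds p, ∀ ε > 0, ∃ (ι : Type) (_ : Fintype ι)
      (Λ : ι → Lp ℝ 2 (γ.area.restrict D) →L[ℝ] ℝ), ∀ f ∈ F₀ n D, ∀ u ∈ γ.W12 D,
      u.fst =ᵐ[γ.area.restrict D] f →
      ∫⁻ q in S, ‖D.indicator f q‖ₑ ^ 2 ∂γ.area ≤
        ENNReal.ofReal (∑ k, (Λ k u.fst) ^ 2 + ε * ‖u.snd‖ ^ 2) := by
  set φ := chartAt (EuclideanSpace ℝ (Fin n)) p
  have hφ : φ ∈ IsManifold.maximalAtlas (𝓡 n) ∞ M := IsManifold.chart_mem_maximalAtlas p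
  have hp : p ∈ φ.source := mem_chart_source _ p
  obtain ⟨r, hr, hrφ⟩ := Metric.nhds_basis_closedBall.mem_iff.mp
    (φ.open_target.mem_nhds (φ.map_source hp))
  set K := Metric.closedBall (φ p) r
  have hK : IsCompact K := isCompact_closedBall _ _
  have hS : φ.symm '' K ∈ nhds p := by
    have := φ.symm.image_mem_nhds (φ.map_source hp) (Metric.closedBall_mem_nhds (φ p) hr)
    rwa [φ.left_inv hp] at this
  refine ⟨φ.symm '' K, hS, fun ε hε => ?_⟩
  obtain ⟨κ, hκ0, hκ⟩ := γ.exists_lintegral_cell_le hφ hD hK hrφ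
  -- The cell diameter is chosen so that `κ * d ^ 2 ≤ ε`. The neighbourhood itself was fixed before
  -- `ε`.
  set d : ℝ := Real.sqrt (ε / (κ + 1))
  have hd : 0 < d := Real.sqrt_pos.mpr (by positivity)
  have hκd : κ * d ^ 2 ≤ ε := by
    rw [Real.sq_sqrt (by positivity), mul_div_assoc', div_le_iff₀ (by positivity)]
    nlinarith
  obtain ⟨ι, hι, Q, hQ, hdisj, hcov⟩ := exists_convex_partition (convex_closedBall (φ p) r)
    hK.measurableSet hK.isBounded hd
  set A : ι → Set M := fun k => φ.symm '' Q k with hA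
  have hQφ : ∀ k, Q k ⊆ φ.target := fun k => (hQ k).2.2.1.trans hrφ
  have hAm : ∀ k, MeasurableSet (A k) := fun k => measurableSet_image_symm (hQφ k) (hQ k).2.1
  have hAfin : ∀ k, γ.area.restrict D (A k) ≠ ⊤ := fun k =>
    ((Measure.restrict_le_self (A k)).trans_lt
      ((measure_mono (image_mono (hQ k).2.2.1)).trans_lt
        (γ.area_image_lt_top hφ hK hrφ))).ne
  have hAdisj : Pairwise (Function.onFun Disjoint A) := fun k l hkl => by
    rw [Function.onFun, Set.disjoint_left]
    rintro _ ⟨y, hy, rfl⟩ ⟨z, hz, hzy⟩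
    have : z = y := φ.symm.injOn (hQφ l hz) (hQφ k hy) hzy
    exact Set.disjoint_left.mp (hdisj hkl) hy (this ▸ hz)
  -- The functionals are the integrals over the cells, normalised so that their squares are the mean
  -- terms of the cell estimate. As inner products with indicators they are continuous on `L²(D)`.
  refine ⟨ι, hι, fun k => Real.sqrt (γ.area.real (A k))⁻¹ •
    innerSL ℝ (indicatorConstLp 2 (hAm k) (hAfin k) (1 : ℝ)), fun f hf u hu huf => ?_⟩
  set Λ : ι → Lp ℝ 2 (γ.area.restrict D) →L[ℝ] ℝ := fun k => Real.sqrt (γ.area.real (A k))⁻¹ •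
    innerSL ℝ (indicatorConstLp 2 (hAm k) (hAfin k) (1 : ℝ)) with hΛ
  have hint : ∀ k, (Λ k u.fst) ^ 2 = (γ.area.real (A k))⁻¹ *
      (∫ q in A k, D.indicator f q ∂γ.area) ^ 2 := fun k => by
    have h1 : Λ k u.fst = Real.sqrt (γ.area.real (A k))⁻¹ *
        ∫ q in A k, D.indicator f q ∂γ.area := by
      simp only [hΛ, smul_apply, innerSL_apply_apply, smul_eq_mul]
      rw [L2.inner_indicatorConstLp_one]
      congr 1
      rw [integral_congr_ae (ae_restrict_of_ae huf), setIntegral_indicator hD.measurableSet,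
        Measure.restrict_restrict (hAm k)]
    rw [h1, mul_pow, Real.sq_sqrt (inv_nonneg.mpr measureReal_nonneg)]
  have hsum : ∑ k, ∫⁻ q in A k, ‖u.snd q‖ₑ ^ 2 ∂(γ.area.restrict D) ≤
      ENNReal.ofReal (‖u.snd‖ ^ 2) := by
    rw [← lintegral_enorm_sq_eq, ← tsum_fintype (L := .unconditional ι),
      ← lintegral_iUnion hAm hAdisj]
    exact setLIntegral_le_lintegral _ _
  calc ∫⁻ q in φ.symm '' K, ‖D.indicator f q‖ₑ ^ 2 ∂γ.area
      ≤ ∫⁻ q in ⋃ k, A k, ‖D.indicator f q‖ₑ ^ 2 ∂γ.area := by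
        refine lintegral_mono_set ?_
        rw [hA, ← image_iUnion]
        exact image_mono hcov
    _ = ∑ k, ∫⁻ q in A k, ‖D.indicator f q‖ₑ ^ 2 ∂γ.area := by
        rw [lintegral_iUnion hAm hAdisj, tsum_fintype]
    _ ≤ ∑ k, (ENNReal.ofReal ((Λ k u.fst) ^ 2) + ENNReal.ofReal (κ * d ^ 2) *
          ∫⁻ q in A k, ‖u.snd q‖ₑ ^ 2 ∂(γ.area.restrict D)) := by
        refine Finset.sum_le_sum fun k _ => ?_
        rw [hint k]
        exact hκ (Q k) (hQ k).2.2.1 (hQ k).1 (hQ k).2.1 d hd.le (hQ k).2.2.2 f hf u hu huf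
    _ ≤ ENNReal.ofReal (∑ k, (Λ k u.fst) ^ 2) +
          ENNReal.ofReal ε * ENNReal.ofReal (‖u.snd‖ ^ 2) := by
        rw [Finset.sum_add_distrib, ← Finset.mul_sum,
          ENNReal.ofReal_sum_of_nonneg fun k _ => sq_nonneg _]
        exact add_le_add le_rfl (mul_le_mul' (ENNReal.ofReal_le_ofReal hκd) hsum)
    _ = _ := by
        rw [← ENNReal.ofReal_mul hε.le, ← ENNReal.ofReal_add (by positivity) (by positivity)]

/-- A quantitative form of the compactness of the embedding of `E(D)` in `L²(D)`. -/
theorem exists_functionals_interW12 [IsManifold (𝓡 n) ∞ M] (hD : IsOpen D)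
    (hc : IsCompact (closure D)) {ε : ℝ} (hε : 0 < ε) :
    ∃ (ι : Type) (_ : Fintype ι) (Λ : ι → Lp ℝ 2 (γ.area.restrict D) →L[ℝ] ℝ),
      ∀ u ∈ γ.interW12 D (F₀ n D),
        ‖u.1.fst‖ ^ 2 ≤ ∑ k, (Λ k u.1.fst) ^ 2 + ε * ‖u.1.snd‖ ^ 2 := by
  have key : ∀ ε > 0, ∃ (ι : Type) (_ : Fintype ι)
      (Λ : ι → Lp ℝ 2 (γ.area.restrict D) →L[ℝ] ℝ), ∀ f ∈ F₀ n D, ∀ u ∈ γ.W12 D,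
      u.fst =ᵐ[γ.area.restrict D] f →
      ∫⁻ q in closure D, ‖D.indicator f q‖ₑ ^ 2 ∂γ.area ≤
        ENNReal.ofReal (∑ k, (Λ k u.fst) ^ 2 + ε * ‖u.snd‖ ^ 2) := by
    -- The estimate is local, passes to subsets, and passes to unions by collecting the functionals.
    -- Requiring it for every `ε` allows each half of a union to use `ε / 2`, as the full energy
    -- appears in both.
    refine hc.induction_on (p := fun S => ∀ ε > 0, ∃ (ι : Type) (_ : Fintype ι)
      (Λ : ι → Lp ℝ 2 (γ.area.restrict D) →L[ℝ] ℝ), ∀ f ∈ F₀ n D, ∀ u ∈ γ.W12 D,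
      u.fst =ᵐ[γ.area.restrict D] f →
      ∫⁻ q in S, ‖D.indicator f q‖ₑ ^ 2 ∂γ.area ≤
        ENNReal.ofReal (∑ k, (Λ k u.fst) ^ 2 + ε * ‖u.snd‖ ^ 2)) ?_ ?_ ?_ ?_
    · exact fun ε _ => ⟨PEmpty, inferInstance, PEmpty.elim, fun f _ u _ _ => by simp⟩
    · intro S T hST hT ε hε
      obtain ⟨ι, hι, Λ, h⟩ := hT ε hε
      exact ⟨ι, hι, Λ, fun f hf u hu huf =>
        (lintegral_mono_set hST).trans (h f hf u hu huf)⟩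
    · intro S T hS hT ε hε
      obtain ⟨ι, hι, Λ, h⟩ := hS (ε / 2) (by positivity)
      obtain ⟨ι', hι', Λ', h'⟩ := hT (ε / 2) (by positivity)
      refine ⟨ι ⊕ ι', inferInstance, Sum.elim Λ Λ', fun f hf u hu huf => ?_⟩
      refine (lintegral_union_le _ S T).trans
        ((add_le_add (h f hf u hu huf) (h' f hf u hu huf)).trans ?_)
      rw [← ENNReal.ofReal_add (by positivity) (by positivity)]
      refine ENNReal.ofReal_le_ofReal (le_of_eq ?_)
      simp only [Fintype.sum_sum_type, Sum.elim_inl, Sum.elim_inr]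
      ring
    · intro p _
      obtain ⟨S, hS, h⟩ := γ.exists_nhds_functionals hD p
      exact ⟨S, nhdsWithin_le_nhds hS, h⟩
  obtain ⟨ι, hι, Λ, h⟩ := key ε hε
  refine ⟨ι, hι, Λ, ?_⟩
  rintro u ⟨f, hf, huf⟩
  rw [← ENNReal.ofReal_le_ofReal_iff (by positivity), ← lintegral_enorm_sq_eq]
  refine le_trans (le_of_eq ?_) ((lintegral_mono_set subset_closure).trans (h f hf u.1 u.2 huf))
  refine lintegral_congr_ae ?_
  filter_upwards [huf, ae_restrict_mem hD.measurableSet] with q hq hqD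
  rw [hq, indicator_of_mem hqD]

/-- The function in `L²(D)` of an element of `W^{1,2}(D)`. -/
noncomputable def fstW12 (D : Set M) : γ.W12 D →L[ℝ] Lp ℝ 2 (γ.area.restrict D) :=
  (WithLp.fstL 2 ℝ _ _).comp (γ.W12 D).subtypeL

/-- The gradient in `L²(D)` of an element of `W^{1,2}(D)`. -/
noncomputable def sndW12 (D : Set M) :
    γ.W12 D →L[ℝ] Lp (EuclideanSpace ℝ (Fin (n + 1))) 2 (γ.area.restrict D) :=
  (WithLp.sndL 2 ℝ _ _).comp (γ.W12 D).subtypeL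

/-- Both sides are continuous on `W^{1,2}(D)`, so the inequality holds on the closure. -/
theorem exists_functionals_spaceE [IsManifold (𝓡 n) ∞ M] (hD : IsOpen D)
    (hc : IsCompact (closure D)) {ε : ℝ} (hε : 0 < ε) :
    ∃ (ι : Type) (_ : Fintype ι) (Λ : ι → Lp ℝ 2 (γ.area.restrict D) →L[ℝ] ℝ),
      ∀ u ∈ γ.spaceE D,
        ‖γ.fstW12 D u‖ ^ 2 ≤ ∑ k, (Λ k (γ.fstW12 D u)) ^ 2 + ε * ‖γ.sndW12 D u‖ ^ 2 := by
  obtain ⟨ι, hι, Λ, h⟩ := γ.exists_functionals_interW12 hD hc hε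
  refine ⟨ι, hι, Λ, fun u hu => ?_⟩
  have hcl : IsClosed {u : γ.W12 D | ‖γ.fstW12 D u‖ ^ 2 ≤
      ∑ k, (Λ k (γ.fstW12 D u)) ^ 2 + ε * ‖γ.sndW12 D u‖ ^ 2} :=
    isClosed_le (by fun_prop) (by fun_prop)
  exact closure_minimal h hcl hu

end Functionals

/-! ### The mean value constraint has codimension at most one -/

section Constraint

variable {n : ℕ} {M : Type*} [TopologicalSpace M] [ChartedSpace (EuclideanSpace ℝ (Fin n)) M]
  [T2Space M] [MeasurableSpace M] [BorelSpace M] (γ : ImmersedHypersurface n M) {D : Set M}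

theorem spaceH_le_spaceE (D : Set M) : γ.spaceH D ≤ γ.spaceE D :=
  Submodule.topologicalClosure_mono fun _ ⟨f, hf, hu⟩ => ⟨f, hf.1, hu⟩

/-- The functions in `E(D)` with mean value zero belong to `H(D)`. -/
theorem exists_functional_spaceH (hD : γ.area D ≠ ⊤) :
    ∃ ℓ : γ.W12 D →L[ℝ] ℝ, ∀ u ∈ γ.spaceE D, ℓ u = 0 → u ∈ γ.spaceH D := by
  have hfin : IsFiniteMeasure (γ.area.restrict D) :=
    ⟨by simpa using lt_top_iff_ne_top.mpr hD⟩
  set ℓ : γ.W12 D →L[ℝ] ℝ := (innerSL ℝ (indicatorConstLp 2 MeasurableSet.univ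
    (measure_ne_top (γ.area.restrict D) univ) (1 : ℝ))).comp (γ.fstW12 D) with hℓ
  have hℓe : ∀ u, ℓ u = ∫ p in D, u.1.fst p ∂γ.area := fun u => by
    have h := L2.inner_indicatorConstLp_one (𝕜 := ℝ) MeasurableSet.univ
      (measure_ne_top (γ.area.restrict D) univ) u.1.fst
    rw [Measure.restrict_univ] at h
    exact h
  have hmem : ∀ u ∈ γ.interW12 D (F₀ n D), ℓ u = 0 → u ∈ γ.interW12 D (γ.G₀ D) := by
    rintro u ⟨f, hf, huf⟩ h0
    refine ⟨f, ⟨hf, ?_, ?_⟩, huf⟩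
    · exact ((Lp.memLp u.1.fst).integrable (by norm_num)).congr huf
    · rw [← integral_congr_ae huf, ← hℓe, h0]
  refine ⟨ℓ, fun u hu h0 => ?_⟩
  -- If some `g` in the dense subspace has nonzero integral, approximants `w` of `u` are corrected
  -- to `w - (ℓ w / ℓ g) • g`. The correction is continuous, lands in mean value zero, and fixes `u`
  -- because `ℓ u = 0`.
  by_cases hall : ∀ w ∈ γ.interW12 D (F₀ n D), ℓ w = 0
  · exact closure_mono (fun w hw => hmem w hw (hall w hw)) hu
  · push Not at hall
    obtain ⟨g, hg, hgℓ⟩ := hall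
    have hcont : Continuous fun w : γ.W12 D => w - (ℓ w / ℓ g) • g := by fun_prop
    have h1 := map_mem_closure (t := (γ.interW12 D (γ.G₀ D) : Set (γ.W12 D))) hcont hu
      fun w hw => by
        refine hmem _ (Submodule.sub_mem _ hw (Submodule.smul_mem _ _ hg)) ?_
        rw [map_sub, map_smul, smul_eq_mul, div_mul_cancel₀ _ hgℓ, sub_self]
    rw [h0, zero_div, zero_smul, sub_zero] at h1
    exact h1

end Constraint

/-! ### The stability form and its indices -/

section StabilityForm

variable {n : ℕ} {M : Type*} [TopologicalSpace M] [ChartedSpace (EuclideanSpace ℝ (Fin n)) M]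
  [T2Space M] [MeasurableSpace M] [BorelSpace M] (γ : ImmersedHypersurface n M) {D : Set M}

theorem integrable_normSqB_mul {M : Type*} [TopologicalSpace M]
    [ChartedSpace (EuclideanSpace ℝ (Fin n)) M] [MeasurableSpace M] [BorelSpace M]
    (γ : ImmersedHypersurface n M) {D : Set M} [IsManifold (𝓡 n) ∞ M] (hD : MeasurableSet D) {C : ℝ}
    (hC : ∀ p ∈ D, ‖γ.normSqB p‖ ≤ C) (f g : Lp ℝ 2 (γ.area.restrict D)) :
    Integrable (fun p => γ.normSqB p * (f p * g p)) (γ.area.restrict D) := by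
  have h : Integrable (fun p => f p * g p) (γ.area.restrict D) := by
    have := L2.integrable_inner (𝕜 := ℝ) g f
    simpa using this
  exact h.bdd_mul γ.continuous_normSqB.measurable.aestronglyMeasurable
    ((ae_restrict_mem hD).mono hC)

/-- The bound on `|B|²` makes both terms integrable separately; bilinearity and the lower bound on
the form rest on this splitting. -/
theorem stabilityForm_eq [IsManifold (𝓡 n) ∞ M] (hD : MeasurableSet D) {C : ℝ}
    (hC : ∀ p ∈ D, ‖γ.normSqB p‖ ≤ C) (u w : γ.W12 D) :
    γ.stabilityForm D u w = inner ℝ (γ.sndW12 D u) (γ.sndW12 D w) -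
      ∫ p in D, γ.normSqB p * (γ.fstW12 D u p * γ.fstW12 D w p) ∂γ.area := by
  rw [L2.inner_def]
  exact integral_sub (L2.integrable_inner _ _) (γ.integrable_normSqB_mul hD hC _ _)

theorem stabilityForm_comm (u w : γ.W12 D) : γ.stabilityForm D u w = γ.stabilityForm D w u := by
  refine integral_congr_ae (Filter.Eventually.of_forall fun p => ?_)
  dsimp only
  rw [real_inner_comm, mul_comm (u.1.fst p)]

theorem stabilityForm_add_left [IsManifold (𝓡 n) ∞ M] (hD : MeasurableSet D) {C : ℝ}
    (hC : ∀ p ∈ D, ‖γ.normSqB p‖ ≤ C) (u u' w : γ.W12 D) :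
    γ.stabilityForm D (u + u') w = γ.stabilityForm D u w + γ.stabilityForm D u' w := by
  rw [γ.stabilityForm_eq hD hC, γ.stabilityForm_eq hD hC, γ.stabilityForm_eq hD hC, map_add,
    map_add, inner_add_left]
  have h : ∫ p in D, γ.normSqB p *
      ((γ.fstW12 D u + γ.fstW12 D u') p * γ.fstW12 D w p) ∂γ.area =
      ∫ p in D, (γ.normSqB p * (γ.fstW12 D u p * γ.fstW12 D w p) +
        γ.normSqB p * (γ.fstW12 D u' p * γ.fstW12 D w p)) ∂γ.area := by
    refine integral_congr_ae ?_
    filter_upwards [Lp.coeFn_add (γ.fstW12 D u) (γ.fstW12 D u')] with p hp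
    rw [hp, Pi.add_apply]
    ring
  rw [h, integral_add (γ.integrable_normSqB_mul hD hC _ _)
    (γ.integrable_normSqB_mul hD hC _ _)]
  ring

theorem stabilityForm_smul_left [IsManifold (𝓡 n) ∞ M] (hD : MeasurableSet D) {C : ℝ}
    (hC : ∀ p ∈ D, ‖γ.normSqB p‖ ≤ C) (a : ℝ) (u w : γ.W12 D) :
    γ.stabilityForm D (a • u) w = a * γ.stabilityForm D u w := by
  rw [γ.stabilityForm_eq hD hC, γ.stabilityForm_eq hD hC, map_smul, map_smul,
    real_inner_smul_left]
  have h : ∫ p in D, γ.normSqB p * ((a • γ.fstW12 D u) p * γ.fstW12 D w p) ∂γ.area =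
      ∫ p in D, a * (γ.normSqB p * (γ.fstW12 D u p * γ.fstW12 D w p)) ∂γ.area := by
    refine integral_congr_ae ?_
    filter_upwards [Lp.coeFn_smul a (γ.fstW12 D u)] with p hp
    rw [hp, Pi.smul_apply, smul_eq_mul]
    ring
  rw [h, integral_const_mul]
  ring

/-- The stability form as a bilinear form. -/
noncomputable def stabilityBilin [IsManifold (𝓡 n) ∞ M] (hD : MeasurableSet D) {C : ℝ}
    (hC : ∀ p ∈ D, ‖γ.normSqB p‖ ≤ C) : LinearMap.BilinForm ℝ (γ.W12 D) :=
  LinearMap.mk₂ ℝ (γ.stabilityForm D) (γ.stabilityForm_add_left hD hC)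
    (γ.stabilityForm_smul_left hD hC)
    (fun w u u' => by
      rw [γ.stabilityForm_comm w, γ.stabilityForm_add_left hD hC, γ.stabilityForm_comm u,
        γ.stabilityForm_comm u'])
    (fun a w u => by
      rw [γ.stabilityForm_comm w, γ.stabilityForm_smul_left hD hC, γ.stabilityForm_comm u]
      rfl)

theorem le_stabilityForm [IsManifold (𝓡 n) ∞ M] (hD : MeasurableSet D) {C : ℝ}
    (hC : ∀ p ∈ D, ‖γ.normSqB p‖ ≤ C) (u : γ.W12 D) :
    ‖γ.sndW12 D u‖ ^ 2 - C * ‖γ.fstW12 D u‖ ^ 2 ≤ γ.stabilityForm D u u := by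
  rw [γ.stabilityForm_eq hD hC, real_inner_self_eq_norm_sq,
    ← real_inner_self_eq_norm_sq (γ.fstW12 D u), L2.inner_def, ← integral_const_mul]
  refine sub_le_sub_left ?_ _
  refine integral_mono_ae (γ.integrable_normSqB_mul hD hC _ _)
    ((L2.integrable_inner _ _).const_mul C) ?_
  filter_upwards [ae_restrict_mem hD] with p hp
  rw [real_inner_self_eq_norm_sq, Real.norm_eq_abs, sq_abs, ← sq]
  exact mul_le_mul_of_nonneg_right ((le_abs_self _).trans (hC p hp)) (sq_nonneg _)

/-- The Morse indices of the stability form on `E(D)` and on `H(D)`, for an open set `D` with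
compact closure. -/
theorem exists_isMorseIndex_formI_formITilde [IsManifold (𝓡 n) ∞ M] (hD : IsOpen D)
    (hc : IsCompact (closure D)) :
    ∃ i j : ℕ, IsMorseIndex (γ.formI D) i ∧ IsMorseIndex (γ.formITilde D) j ∧
      (i : ℤ) - 1 ≤ j ∧ j ≤ i := by
  obtain ⟨C, hC⟩ := hc.exists_bound_of_continuousOn γ.continuous_normSqB.continuousOn
  replace hC : ∀ p ∈ D, ‖γ.normSqB p‖ ≤ |C| := fun p hp =>
    (hC p (subset_closure hp)).trans (le_abs_self C)
  -- With this `ε`, the vanishing of all `Λ k` gives `(|C| + 1)‖f‖² ≤ ‖Df‖²`, so the form is at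
  -- least `‖f‖² ≥ 0` there.
  obtain ⟨ι, hι, Λ, hΛ⟩ := γ.exists_functionals_spaceE hD hc
    (ε := (|C| + 1)⁻¹) (by positivity)
  obtain ⟨ℓ, hℓ⟩ := γ.exists_functional_spaceH
    (((measure_mono subset_closure).trans_lt (γ.area_lt_top_of_isCompact hc)).ne)
  refine exists_isMorseIndex_of_codim_le_one
    (B := (γ.stabilityBilin hD.measurableSet hC).compl₁₂ (γ.spaceE D).subtype
      (γ.spaceE D).subtype)
    (fun u w => γ.stabilityForm_comm u.1 w.1)
    (LinearMap.pi fun k => ((Λ k).comp (γ.fstW12 D)).toLinearMap.comp (γ.spaceE D).subtype) ?_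
    (Submodule.inclusion (γ.spaceH_le_spaceE D)) (Submodule.inclusion_injective _)
    (ℓ.toLinearMap.comp (γ.spaceE D).subtype) ?_
  · intro u hu h0
    have h1 : ∀ k, Λ k (γ.fstW12 D u.1) = 0 := fun k => congrFun h0 k
    have h2 := hΛ u.1 u.2
    simp only [h1, ne_eq, OfNat.ofNat_ne_zero, not_false_eq_true, zero_pow,
      Finset.sum_const_zero, zero_add] at h2
    have h3 := γ.le_stabilityForm hD.measurableSet hC u.1
    have h4 : γ.stabilityForm D u.1 u.1 < 0 := hu
    rw [inv_mul_eq_div, le_div_iff₀ (by positivity)] at h2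
    nlinarith [sq_nonneg ‖γ.fstW12 D u.1‖]
  · intro u hu
    exact ⟨⟨u.1, hℓ u.1 u.2 hu⟩, rfl⟩

end StabilityForm

end ImmersedHypersurface

end CMCIndex

theorem lemmaD {n : ℕ} [NeZero n] {M : Type*} [TopologicalSpace M] [T2Space M]
    [SecondCountableTopology M] [ChartedSpace (EuclideanSpace ℝ (Fin n)) M]
    [IsManifold (𝓡 n) ∞ M] [MeasurableSpace M] [BorelSpace M]
    (γ : CMCIndex.ImmersedHypersurface n M) (hγ : γ.IsCMC)
    (b : ℝ) (D : ℝ → Set M) (hD : CMCIndex.IsC0MonotoneContinuum n b D)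
    (t : ℝ) (ht : t ∈ Set.Icc 0 b) :
    ∃ i j : ℕ, CMCIndex.IsMorseIndex (γ.formI (D t)) i ∧
      CMCIndex.IsMorseIndex (γ.formITilde (D t)) j ∧
      (i : ℤ) - 1 ≤ j ∧ j ≤ i :=
  γ.exists_isMorseIndex_formI_formITilde (hD.lipschitz t ht).isOpen
    (hD.lipschitz t ht).isCompact_closure
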